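/- Let $k$ be a field, $V$ a finite-dimensional $k$-vector space (in degree $1$), $V^{(n)}=V^{\otimes n}$, and $S$ a finite set of integers $\ge 2$. Let $R=\bigoplus_{s\in S}R_s$ with subspaces $R_s\subseteq V^{(s)}$ satisfying the minimality condition $$R_s\cap\sum_{t\in S,\ t<s}\ \sum_{j=0}^{s-t}V^{(j)}\otimes R_t\otimes V^{(s-t-j)}=0\qquad(s\in S),$$ and let $A=T(V)/\langle R\rangle$, an $S$-multi-homogeneous algebra with space of relations $R$. For $s\in S$ put $n_s(2l)=sl$, $n_s(2l+1)=sl+1$. Put $J_0=k$, $J_1=V$ and, for $i\ge 2$, $J_i=\bigoplus_{s\in S}J_i^s$ with $$J_i^s=\bigcap_{j=0}^{n_s(i)-s}V^{(j)}\otimes R_s\otimes V^{(n_s(i)-s-j)}\subseteq V^{(n_s(i))}.$$ The left multi-Koszul complex of $A$ has terms $K(A)_i=A\otimes J_i$ $(i\ge 0)$; its differential $\delta_1:A\otimes V\to A$ is multiplication, and, for $i\ge 2$, $\delta_i:A\otimes J_i\to A\otimes J_{i-1}$ is given on $A\otimes J_i^s$ by the restriction of $\alpha\otimes v_1\cdots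 v_{n_s(i)}\mapsto \alpha v_1\cdots v_p\otimes v_{p+1}\cdots v_{n_s(i)}$, where $p=s-1$ if $i$ is even and $p=1$ if $i$ is odd. The algebra $A$ is called left multi-Koszul if this complex, augmented by the canonical augmentation $A\to k$, is a projective resolution of the trivial left $A$-module $k$. The right multi-Koszul complex, with terms $J_i\otimes A$, is defined symmetrically (the last $p$ letters are moved into $A$ from the left), and $A$ is called right multi-Koszul if that complex, augmented by $A\to k$, is a projective resolution of the trivial right $A$-module $k$. Let $\tau:T(V)\to T(V)$ be the reversal $\tau(w_1\cdots w_n)=w_n\cdots w_1$, and let $A^\circ=T(V)/\langle\tau(R)\rangle$ be the opposite $S$-multi-homogeneous algebra, with space of relations $\bigoplus_{s\in S}\tau(R_s)$. Then $A$ is left multi-Koszul if and only if it is right multi-Koszul. Consequently $A^\circ$ is multi-Koszul if and only if $A$ is; that is, $A^\circ$ is left multi-Koszul if and only if $A$ is left multi-Koszul, and $A^\circ$ is right multi-Koszul if and only if $A$ is right multi-Koszul. -/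

import Mathlib

open scoped TensorProduct DirectSum

noncomputable section

namespace MultiKoszul

section Tensor

variable {k V : Type*} [Field k] [AddCommGroup V] [Module k V]

/-- The subspace `V^(n)` of the tensor algebra `T(V)`, that is, the `n`-th tensor power of `V`;
in particular `V^(0) = k`. -/
def tpow (k V : Type*) [Field k] [AddCommGroup V] [Module k V] (n : ℕ) :
    Submodule k (TensorAlgebra k V) :=
  LinearMap.range (TensorAlgebra.ι k (M := V)) ^ n

theorem tpow_zero : tpow k V 0 = 1 := pow_zero _

theorem tpow_one : tpow k V 1 = LinearMap.range (TensorAlgebra.ι k (M := V)) := pow_one _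

theorem tpow_add (m n : ℕ) : tpow k V (m + n) = tpow k V m * tpow k V n := pow_add _ m n

/-- The anti-automorphism `τ` of `T(V)` as a homomorphism to the opposite algebra. -/
def revOp (k V : Type*) [Field k] [AddCommGroup V] [Module k V] :
    TensorAlgebra k V →ₐ[k] (TensorAlgebra k V)ᵐᵒᵖ :=
  TensorAlgebra.lift k
    ((MulOpposite.opLinearEquiv k).toLinearMap ∘ₗ TensorAlgebra.ι k)

/-- The reversal `τ : T(V) → T(V)`, `τ(w₁ w₂ ⋯ wₙ) = wₙ ⋯ w₂ w₁`. -/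
def rev (k V : Type*) [Field k] [AddCommGroup V] [Module k V] :
    TensorAlgebra k V →ₗ[k] TensorAlgebra k V :=
  (MulOpposite.opLinearEquiv k).symm.toLinearMap ∘ₗ (revOp k V).toLinearMap

theorem rev_ι (v : V) : rev k V (TensorAlgebra.ι k v) = TensorAlgebra.ι k v := by
  simp [rev, revOp]

theorem rev_one : rev k V 1 = 1 := by simp [rev]

theorem rev_mul (x y : TensorAlgebra k V) : rev k V (x * y) = rev k V y * rev k V x := by
  simp [rev]

theorem rev_rev (x : TensorAlgebra k V) : rev k V (rev k V x) = x := by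
  induction x using TensorAlgebra.induction with
  | algebraMap r => simp [Algebra.algebraMap_eq_smul_one, rev_one]
  | ι v => simp [rev_ι]
  | mul a b ha hb => simp [rev_mul, ha, hb]
  | add a b ha hb => simp [ha, hb]

theorem rev_injective : Function.Injective (rev k V) :=
  Function.LeftInverse.injective rev_rev

theorem map_rev_map_rev (M : Submodule k (TensorAlgebra k V)) :
    (M.map (rev k V)).map (rev k V) = M := by
  rw [← Submodule.map_comp]
  convert Submodule.map_id M
  ext x
  simp [rev_rev]

theorem map_rev_mul (M N : Submodule k (TensorAlgebra k V)) :
    (M * N).map (rev k V) = N.map (rev k V) * M.map (rev k V) := by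
  apply le_antisymm
  · rw [Submodule.map_le_iff_le_comap, Submodule.mul_le]
    intro m hm n hn
    rw [Submodule.mem_comap, rev_mul]
    exact Submodule.mul_mem_mul (Submodule.mem_map_of_mem hn) (Submodule.mem_map_of_mem hm)
  · rw [Submodule.mul_le]
    rintro _ ⟨n, hn, rfl⟩ _ ⟨m, hm, rfl⟩
    rw [← rev_mul]
    exact Submodule.mem_map_of_mem (Submodule.mul_mem_mul hm hn)

theorem map_rev_tpow (n : ℕ) : (tpow k V n).map (rev k V) = tpow k V n := by
  induction n with
  | zero =>
    rw [tpow_zero, Submodule.one_eq_span, Submodule.map_span, Set.image_singleton, rev_one]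
  | succ n ih =>
    have h1 : (tpow k V 1).map (rev k V) = tpow k V 1 := by
      rw [tpow_one, ← LinearMap.range_comp]
      congr 1
      ext v
      simp [rev_ι]
    rw [tpow_add, map_rev_mul, h1, ih, ← tpow_add, ← tpow_add, add_comm]

/-- Auxiliary to `contract`: left multiplication by `v` together with the removal of `v`. -/
def contractAux (φ : Module.Dual k V) :
    V →ₗ[k] Module.End k (TensorAlgebra k V × TensorAlgebra k V) where
  toFun v := (LinearMap.mulLeft k (TensorAlgebra.ι k v) ∘ₗ LinearMap.fst k _ _).prod
    (φ v • LinearMap.fst k _ _)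
  map_add' v w := by
    ext x <;> simp [add_mul, add_smul]
  map_smul' c v := by
    ext x <;> simp [mul_smul]

/-- Contraction of the first letter with a linear form:
`v₁ v₂ ⋯ vₙ ↦ φ(v₁) v₂ ⋯ vₙ`, and `1 ↦ 0`. -/
def contract (φ : Module.Dual k V) : TensorAlgebra k V →ₗ[k] TensorAlgebra k V :=
  LinearMap.snd k _ _ ∘ₗ LinearMap.applyₗ ((1 : TensorAlgebra k V), (0 : TensorAlgebra k V)) ∘ₗ
    (TensorAlgebra.lift k (contractAux φ)).toLinearMap

theorem lift_contractAux_fst (φ : Module.Dual k V) (x : TensorAlgebra k V)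
    (y : TensorAlgebra k V × TensorAlgebra k V) :
    (TensorAlgebra.lift k (contractAux φ) x y).1 = x * y.1 := by
  induction x using TensorAlgebra.induction generalizing y with
  | algebraMap r => simp [Algebra.algebraMap_eq_smul_one]
  | ι v => simp [contractAux]
  | mul a b ha hb => simp [ha, hb, mul_assoc]
  | add a b ha hb => simp [ha, hb, add_mul]

theorem contract_ι_mul (φ : Module.Dual k V) (v : V) (x : TensorAlgebra k V) :
    contract φ (TensorAlgebra.ι k v * x) = φ v • x := by
  have := lift_contractAux_fst φ x (1, 0)
  simp only [mul_one] at this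
  have h2 : contractAux φ v (TensorAlgebra.lift k (contractAux φ) x (1, 0)) =
      (TensorAlgebra.ι k v * (TensorAlgebra.lift k (contractAux φ) x (1, 0)).1,
        φ v • (TensorAlgebra.lift k (contractAux φ) x (1, 0)).1) := rfl
  simp [contract, h2, this]

theorem sum_ι_mul_contract {ι : Type*} [Fintype ι] (b : Module.Basis ι k V)
    {x : TensorAlgebra k V} (hx : x ∈ tpow k V 1 * (⊤ : Submodule k (TensorAlgebra k V))) :
    ∑ i, TensorAlgebra.ι k (b i) * contract (b.coord i) x = x := by
  induction hx using Submodule.mul_induction_on' with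
  | mem_mul_mem m hm n hn =>
    rw [tpow_one] at hm
    obtain ⟨v, rfl⟩ := hm
    simp_rw [contract_ι_mul, mul_smul_comm, ← smul_mul_assoc, ← Finset.sum_mul, ← map_smul,
      ← map_sum]
    rw [show ∑ i, b.coord i v • b i = v from b.sum_repr v]
  | add x _ y _ hx hy => simp only [map_add, mul_add, Finset.sum_add_distrib, hx, hy]

theorem contract_mem (φ : Module.Dual k V) {W : Submodule k (TensorAlgebra k V)}
    {x : TensorAlgebra k V} (hx : x ∈ tpow k V 1 * W) : contract φ x ∈ W := by
  induction hx using Submodule.mul_induction_on' with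
  | mem_mul_mem m hm n hn =>
    rw [tpow_one] at hm
    obtain ⟨v, rfl⟩ := hm
    rw [contract_ι_mul]
    exact W.smul_mem _ hn
  | add x _ y _ hx hy => rw [map_add]; exact W.add_mem hx hy

theorem iInf_tpow_mul_le [FiniteDimensional k V] {α : Type*} [Nonempty α] (n : ℕ)
    (W : α → Submodule k (TensorAlgebra k V)) :
    ⨅ a, tpow k V n * W a ≤ tpow k V n * ⨅ a, W a := by
  induction n with
  | zero => simp [tpow_zero]
  | succ n ih =>
    simp only [add_comm n 1, tpow_add, mul_assoc]
    refine le_trans ?_ (mul_le_mul_right ih _)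
    intro x hx
    rw [Submodule.mem_iInf] at hx
    let b := Module.finBasis k V
    rw [← sum_ι_mul_contract b (SetLike.le_def.1
      (mul_le_mul_right le_top (tpow k V 1)) (hx (Classical.arbitrary α)))]
    refine Submodule.sum_mem _ fun i _ => Submodule.mul_mem_mul ?_ ?_
    · rw [tpow_one]; exact ⟨_, rfl⟩
    · rw [Submodule.mem_iInf]
      exact fun a => contract_mem _ (hx a)

theorem iInf_mul_tpow_le [FiniteDimensional k V] {α : Type*} [Nonempty α] (n : ℕ)
    (W : α → Submodule k (TensorAlgebra k V)) :
    ⨅ a, W a * tpow k V n ≤ (⨅ a, W a) * tpow k V n := by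
  intro x hx
  have h : rev k V x ∈ tpow k V n * ⨅ a, (W a).map (rev k V) := by
    apply iInf_tpow_mul_le
    rw [Submodule.mem_iInf] at hx ⊢
    intro a
    have := Submodule.mem_map_of_mem (f := rev k V) (hx a)
    rwa [map_rev_mul, map_rev_tpow] at this
  have h2 := Submodule.mem_map_of_mem (f := rev k V) h
  rw [rev_rev, map_rev_mul, map_rev_tpow] at h2
  refine SetLike.le_def.1 (mul_le_mul_left ?_ (tpow k V n)) h2
  refine le_iInf fun a => ?_
  conv_rhs => rw [← map_rev_map_rev (W a)]
  exact Submodule.map_mono (iInf_le _ a)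

theorem linearDisjoint_tpow_one [FiniteDimensional k V]
    (W : Submodule k (TensorAlgebra k V)) : (tpow k V 1).LinearDisjoint W := by
  refine ⟨(injective_iff_map_eq_zero _).2 fun z hz => ?_⟩
  let b := Module.finBasis k V
  let e : V ≃ₗ[k] tpow k V 1 :=
    LinearEquiv.ofInjective (TensorAlgebra.ι k) (TensorAlgebra.ι_leftInverse (R := k)).injective ≪≫ₗ
      LinearEquiv.ofEq _ _ tpow_one.symm
  have he : ∀ v, ((e v : tpow k V 1) : TensorAlgebra k V) = TensorAlgebra.ι k v := fun _ => rfl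
  let f := TensorProduct.equivFinsuppOfBasisLeft (N := W) (b.map e)
  obtain ⟨g, rfl⟩ := f.symm.surjective z
  have hg : ∀ i, (g i : TensorAlgebra k V) =
      contract (b.coord i) (Submodule.mulMap (tpow k V 1) W (f.symm g)) := by
    intro i
    rw [TensorProduct.equivFinsuppOfBasisLeft_symm_apply, Finsupp.sum_fintype _ _ (by simp)]
    simp [he, contract_ι_mul, Finsupp.single_apply]
  have : g = 0 := by
    ext i
    rw [hg i, hz]
    simp
  rw [this, map_zero]

theorem linearDisjoint_mul_left {M N P : Submodule k (TensorAlgebra k V)}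
    (h1 : M.LinearDisjoint N) (h2 : N.LinearDisjoint P) (h3 : M.LinearDisjoint (N * P)) :
    (M * N).LinearDisjoint P := by
  have key : Submodule.mulMap (M * N) P ∘ₗ (LinearEquiv.rTensor P h1.mulMap).toLinearMap =
      Submodule.mulMap M (N * P) ∘ₗ ((TensorProduct.assoc k M N P).trans
        (LinearEquiv.lTensor M h2.mulMap)).toLinearMap := by
    refine TensorProduct.ext_threefold fun x y z => ?_
    simp [mul_assoc]
  have h4 : Function.Injective
      (Submodule.mulMap (M * N) P ∘ₗ (LinearEquiv.rTensor P h1.mulMap).toLinearMap) := by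
    rw [key]
    exact h3.injective.comp (LinearEquiv.injective _)
  rw [LinearMap.coe_comp, LinearEquiv.coe_coe, EquivLike.injective_comp] at h4
  exact ⟨h4⟩

/-- The multiplication `V^(n) ⊗ W → T(V)` is injective. -/
theorem linearDisjoint_tpow_left [FiniteDimensional k V] (n : ℕ)
    (W : Submodule k (TensorAlgebra k V)) : (tpow k V n).LinearDisjoint W := by
  induction n generalizing W with
  | zero => rw [tpow_zero]; exact Submodule.LinearDisjoint.one_left W
  | succ n ih =>
    rw [add_comm, tpow_add]
    exact linearDisjoint_mul_left (linearDisjoint_tpow_one _) (ih W) (linearDisjoint_tpow_one _)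

theorem map_revOp (M : Submodule k (TensorAlgebra k V)) :
    M.map (revOp k V).toLinearMap =
      Submodule.equivOpposite.symm (MulOpposite.op (M.map (rev k V))) := by
  ext x
  constructor
  · rintro ⟨y, hy, rfl⟩
    exact ⟨y, hy, rfl⟩
  · rintro ⟨y, hy, h⟩
    exact ⟨y, hy, MulOpposite.unop_injective h⟩

/-- The multiplication `W ⊗ V^(n) → T(V)` is injective. -/
theorem linearDisjoint_tpow_right [FiniteDimensional k V] (n : ℕ)
    (W : Submodule k (TensorAlgebra k V)) : W.LinearDisjoint (tpow k V n) := by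
  have h := (linearDisjoint_tpow_left n (W.map (rev k V))).map (revOp k V)
    (fun x y h => rev_injective (congrArg MulOpposite.unop h))
  have h2 := h
  rw [show ((revOp k V : TensorAlgebra k V →ₗ[k] _)) = (revOp k V).toLinearMap from rfl,
    map_revOp, map_revOp, map_rev_map_rev, map_rev_tpow] at h2
  exact Submodule.linearDisjoint_op.2 h2

end Tensor
section Degrees

/-- The function `n_s`, `n_s(2l) = s l` and `n_s(2l+1) = s l + 1`. -/
def nfun (s i : ℕ) : ℕ := if Even i then s * (i / 2) else s * (i / 2) + 1

/-- For `i ≥ 2`, the number `n_s(i) - n_s(i-1)` of letters that the `i`-th differential moves from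
the `s`-th summand into the algebra: `s - 1` if `i` is even and `1` if `i` is odd. -/
def moved (s i : ℕ) : ℕ := if Even i then s - 1 else 1

theorem nfun_succ {s : ℕ} (hs : 2 ≤ s) (i : ℕ) : nfun s (i + 1) = nfun s i + moved s (i + 1) := by
  unfold nfun moved
  rcases Nat.even_or_odd' i with ⟨l, rfl | rfl⟩
  · simp
    omega
  · have h1 : (2 * l + 1 + 1) / 2 = l + 1 := by omega
    have h2 : (2 * l + 1) / 2 = l := by omega
    simp [Nat.even_add_one, h1, h2, mul_add]
    omega

theorem le_nfun (s i : ℕ) : s ≤ nfun s (i + 2) := by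
  have h : (i + 2) / 2 = i / 2 + 1 := by omega
  unfold nfun
  rw [h, mul_add]
  split_ifs <;> omega

/-- Index set of the direct sum decomposition of `J_i`: one summand if `i = 0, 1`, and one summand
`J_i^s` for each `s ∈ S` if `i ≥ 2`. -/
def Idx (S : Finset ℕ) : ℕ → Type
  | 0 => Unit
  | 1 => Unit
  | _ + 2 => S

instance (S : Finset ℕ) : ∀ i, DecidableEq (Idx S i)
  | 0 => inferInstanceAs (DecidableEq Unit)
  | 1 => inferInstanceAs (DecidableEq Unit)
  | _ + 2 => inferInstanceAs (DecidableEq S)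

/-- The summand of `J_i` to which the `(i+1)`-st differential sends a given summand of `J_{i+1}`:
the one with the same `s` if `i ≥ 2`, and the only one if `i = 0, 1`. -/
def target (S : Finset ℕ) : (i : ℕ) → Idx S (i + 1) → Idx S i
  | 0, _ => ()
  | 1, _ => ()
  | _ + 2, s => s

/-- The number of letters moved into the algebra by the `(i+1)`-st differential. -/
def letters (S : Finset ℕ) : (i : ℕ) → Idx S (i + 1) → ℕ
  | 0, _ => 1
  | i + 1, s => moved (Subtype.val (p := (· ∈ S)) s) (i + 2)

end Degrees

section Summands

variable {k V : Type*} [Field k] [AddCommGroup V] [Module k V]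

/-- `J_i^s = ⋂_{0 ≤ j ≤ n_s(i) - s} V^(j) ⊗ M ⊗ V^(n_s(i) - s - j)` for `i ≥ 2`, where `M = R_s`. -/
def Jpow (M : Submodule k (TensorAlgebra k V)) (s i : ℕ) : Submodule k (TensorAlgebra k V) :=
  ⨅ j : Fin (nfun s i - s + 1), tpow k V j * M * tpow k V (nfun s i - s - j)

theorem Jpow_two (M : Submodule k (TensorAlgebra k V)) (s : ℕ) : Jpow M s 2 = M := by
  have h : nfun s 2 - s = 0 := by simp [nfun]
  unfold Jpow
  rw [h]
  simp [tpow_zero]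

theorem Jpow_succ_le_left [FiniteDimensional k V] (M : Submodule k (TensorAlgebra k V)) {s : ℕ}
    (hs : 2 ≤ s) (i : ℕ) :
    Jpow M s (i + 3) ≤ tpow k V (moved s (i + 3)) * Jpow M s (i + 2) := by
  refine le_trans ?_ (iInf_tpow_mul_le _ _)
  have h : nfun s (i + 3) = nfun s (i + 2) + moved s (i + 3) := nfun_succ hs (i + 2)
  have h2 := le_nfun s i
  refine le_iInf fun j => ?_
  have hj := j.2
  refine le_trans (iInf_le _ ⟨moved s (i + 3) + j, by omega⟩) ?_
  rw [← mul_assoc, ← mul_assoc, ← tpow_add,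
    show nfun s (i + 3) - s - (moved s (i + 3) + j) = nfun s (i + 2) - s - j by omega]

theorem Jpow_succ_le_right [FiniteDimensional k V] (M : Submodule k (TensorAlgebra k V)) {s : ℕ}
    (hs : 2 ≤ s) (i : ℕ) :
    Jpow M s (i + 3) ≤ Jpow M s (i + 2) * tpow k V (moved s (i + 3)) := by
  refine le_trans ?_ (iInf_mul_tpow_le _ _)
  have h : nfun s (i + 3) = nfun s (i + 2) + moved s (i + 3) := nfun_succ hs (i + 2)
  have h2 := le_nfun s i
  refine le_iInf fun j => ?_
  have hj := j.2
  refine le_trans (iInf_le _ ⟨j, by omega⟩) ?_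
  rw [mul_assoc, mul_assoc, mul_assoc, ← tpow_add,
    show nfun s (i + 2) - s - j + moved s (i + 3) = nfun s (i + 3) - s - j by omega]

end Summands

/-- An `S`-multi-homogeneous algebra `A = T(V)/⟨R⟩`, given by its space of relations
`R = ⨁_{s ∈ S} R_s`: here `S` is a finite set of integers `≥ 2`, `R_s ⊆ V^(s)`, and no `R_s` meets
the part of degree `s` of the ideal generated by the relations of smaller degree
(minimality condition). -/
structure MultiHomogeneous (k V : Type*) [Field k] [AddCommGroup V] [Module k V]
    (S : Finset ℕ) where
  two_le : ∀ s ∈ S, 2 ≤ s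
  R : S → Submodule k (TensorAlgebra k V)
  le_tpow : ∀ s : S, R s ≤ tpow k V s
  minimality : ∀ s : S, R s ⊓ ⨆ t : S, ⨆ _ : (t : ℕ) < s, ⨆ j : Fin ((s : ℕ) - t + 1),
    tpow k V j * R t * tpow k V ((s : ℕ) - t - j) = ⊥

namespace MultiHomogeneous

variable {k V : Type*} [Field k] [AddCommGroup V] [Module k V] {S : Finset ℕ}
  (D : MultiHomogeneous k V S)

/-- The two-sided ideal `⟨R⟩` of `T(V)`. -/
def ideal : Ideal (TensorAlgebra k V) :=
  (TwoSidedIdeal.span (⋃ s, (D.R s : Set (TensorAlgebra k V)))).asIdeal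

instance : D.ideal.IsTwoSided :=
  inferInstanceAs (TwoSidedIdeal.span _).asIdeal.IsTwoSided

/-- The algebra `A = T(V)/⟨R⟩`. -/
abbrev Alg : Type _ := TensorAlgebra k V ⧸ D.ideal

/-- The projection `T(V) → A`. -/
def proj : TensorAlgebra k V →ₐ[k] D.Alg := Ideal.Quotient.mkₐ k D.ideal

theorem algebraMapInv_eq_zero {n : ℕ} {x : TensorAlgebra k V} (hx : x ∈ tpow k V (n + 1)) :
    TensorAlgebra.algebraMapInv x = 0 := by
  rw [tpow_add, tpow_one] at hx
  induction hx using Submodule.mul_induction_on' with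
  | mem_mul_mem m hm n hn =>
    obtain ⟨v, rfl⟩ := hn
    simp [TensorAlgebra.algebraMapInv]
  | add x _ y _ hx hy => rw [map_add, hx, hy, add_zero]

/-- The augmentation `A → k`, which vanishes on `V`. -/
def aug : D.Alg →ₐ[k] k :=
  Ideal.Quotient.liftₐ D.ideal TensorAlgebra.algebraMapInv (by
    intro a ha
    have h : TwoSidedIdeal.span (⋃ s, (D.R s : Set (TensorAlgebra k V))) ≤
        TwoSidedIdeal.ker (TensorAlgebra.algebraMapInv (R := k) (M := V)) := by
      rw [TwoSidedIdeal.span_le]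
      intro x hx
      obtain ⟨s, hs⟩ := Set.mem_iUnion.1 hx
      have h1 := D.le_tpow s hs
      have h2 := D.two_le s s.2
      rw [show (s : ℕ) = (s - 1) + 1 by omega] at h1
      exact (TwoSidedIdeal.mem_ker _).2 (algebraMapInv_eq_zero h1)
    exact (TwoSidedIdeal.mem_ker _).1 (h ha))

/-- The trivial module `k`. -/
def Triv (_ : MultiHomogeneous k V S) : Type _ := k

instance : AddCommGroup D.Triv := inferInstanceAs (AddCommGroup k)
instance : Module k D.Triv := inferInstanceAs (Module k k)

/-- The identification of `k` with the vector space underlying the trivial module. -/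
def toTriv : k ≃ₗ[k] D.Triv := LinearEquiv.refl k k

/-- `k` as a trivial left `A`-module: `a • c = ε(a) c`. -/
instance : Module D.Alg D.Triv := Module.compHom k D.aug.toRingHom

/-- `k` as a trivial right `A`-module: `c • a = c ε(a)`. Right `A`-modules are modules over the
opposite ring. -/
instance : Module D.Algᵐᵒᵖ D.Triv :=
  Module.compHom k (D.aug.toRingHom.fromOpposite fun _ _ => mul_comm _ _)

instance : IsScalarTower k D.Alg D.Triv where
  smul_assoc r a (c : k) := by
    change (D.aug (r • a) * c : k) = r * (D.aug a * c)
    rw [map_smul, smul_eq_mul, mul_assoc]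

instance : IsScalarTower k D.Algᵐᵒᵖ D.Triv where
  smul_assoc r a (c : k) := by
    change (D.aug (r • a.unop) * c : k) = r * (D.aug a.unop * c)
    rw [map_smul, smul_eq_mul, mul_assoc]

/-- The summands of `J_i`: `V^(0) = k` for `i = 0`, `V^(1) = V` for `i = 1`, and the `J_i^s`, `s ∈ S`,
for `i ≥ 2`. -/
def Jsub : (i : ℕ) → Idx S i → Submodule k (TensorAlgebra k V)
  | 0, _ => tpow k V 0
  | 1, _ => tpow k V 1
  | i + 2, s => Jpow (D.R s) (Subtype.val (p := (· ∈ S)) s) (i + 2)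

/-- `J_i = ⨁_{s ∈ S} J_i^s` if `i ≥ 2`, and `J_i = V^(i)` if `i = 0, 1`. -/
abbrev J (i : ℕ) : Type _ := ⨁ c : Idx S i, D.Jsub i c

theorem Jsub_succ_le_left [FiniteDimensional k V] : ∀ (i : ℕ) (c : Idx S (i + 1)),
    D.Jsub (i + 1) c ≤ tpow k V (letters S i c) * D.Jsub i (target S i c)
  | 0, _ => (tpow_add 1 0).le
  | 1, s => by
    obtain ⟨s, hs⟩ := s
    have h2 := D.two_le s hs
    have h3 : moved s 2 + 1 = s := by simp [moved]; omega
    change Jpow (D.R ⟨s, hs⟩) s 2 ≤ tpow k V (moved s 2) * tpow k V 1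
    rw [Jpow_two, ← tpow_add, h3]
    exact D.le_tpow ⟨s, hs⟩
  | i + 2, s => Jpow_succ_le_left _ (D.two_le _ (Subtype.prop (p := (· ∈ S)) s)) i

theorem Jsub_succ_le_right [FiniteDimensional k V] : ∀ (i : ℕ) (c : Idx S (i + 1)),
    D.Jsub (i + 1) c ≤ D.Jsub i (target S i c) * tpow k V (letters S i c)
  | 0, _ => (tpow_add 0 1).le
  | 1, s => by
    obtain ⟨s, hs⟩ := s
    have h2 := D.two_le s hs
    have h3 : 1 + moved s 2 = s := by simp [moved]; omega
    change Jpow (D.R ⟨s, hs⟩) s 2 ≤ tpow k V 1 * tpow k V (moved s 2)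
    rw [Jpow_two, ← tpow_add, h3]
    exact D.le_tpow ⟨s, hs⟩
  | i + 2, s => Jpow_succ_le_right _ (D.two_le _ (Subtype.prop (p := (· ∈ S)) s)) i

section Left

/-- The map `V^(n) W → A ⊗ W`, `v₁ ⋯ vₙ w ↦ v₁ ⋯ vₙ ⊗ w`, obtained from the isomorphism
`V^(n) ⊗ W ≃ V^(n) W` given by the multiplication of `T(V)`. -/
def splitLeft [FiniteDimensional k V] (n : ℕ) (W : Submodule k (TensorAlgebra k V)) :
    (tpow k V n * W : Submodule k (TensorAlgebra k V)) →ₗ[k] D.Alg ⊗[k] W :=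
  LinearMap.rTensor W (D.proj.toLinearMap ∘ₗ (tpow k V n).subtype) ∘ₗ
    (linearDisjoint_tpow_left n W).mulMap.symm.toLinearMap

/-- The module `K(A)_i = A ⊗ J_i` of the left multi-Koszul complex. -/
abbrev KLeft (i : ℕ) : Type _ := D.Alg ⊗[k] D.J i

/-- The left `A`-linear extension `A ⊗ J_i → N`, `α ⊗ x ↦ α • f(x)`, of a linear map `f`. -/
def liftLeft {N : Type*} [AddCommMonoid N] [Module k N] [Module D.Alg N]
    [IsScalarTower k D.Alg N] {i : ℕ} (f : D.J i →ₗ[k] N) :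
    D.KLeft i →ₗ[D.Alg] N where
  toFun := TensorProduct.lift
    (((Algebra.lsmul k k N).toLinearMap : D.Alg →ₗ[k] Module.End k N).flip ∘ₗ f).flip
  map_add' := map_add _
  map_smul' a x := by
    induction x using TensorProduct.induction_on with
    | zero => simp
    | tmul α y => simp [TensorProduct.smul_tmul']
    | add x y hx hy => rw [smul_add, map_add, hx, hy, map_add, smul_add]

/-- The differential `δ_{i+1} : A ⊗ J_{i+1} → A ⊗ J_i` of the left multi-Koszul complex. On the
summand with index `c` it is `α ⊗ v₁ ⋯ vₙ ↦ α v₁ ⋯ vₚ ⊗ vₚ₊₁ ⋯ vₙ` with `p = letters S i c`. -/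
def dLeft [FiniteDimensional k V] (i : ℕ) : D.KLeft (i + 1) →ₗ[D.Alg] D.KLeft i :=
  D.liftLeft (DirectSum.toModule k _ _ fun c =>
    LinearMap.lTensor D.Alg (DirectSum.lof k _ (fun c => D.Jsub i c) (target S i c)) ∘ₗ
      D.splitLeft (letters S i c) (D.Jsub i (target S i c)) ∘ₗ
        Submodule.inclusion (D.Jsub_succ_le_left i c))

/-- The augmentation `δ_0 : K(A)_0 = A ⊗ V^(0) = A → k`, `α ⊗ x ↦ ε(α x)`. -/
def augLeft : D.KLeft 0 →ₗ[D.Alg] D.Triv :=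
  D.liftLeft (DirectSum.toModule k _ _ fun c =>
    D.toTriv.toLinearMap ∘ₗ D.aug.toLinearMap ∘ₗ D.proj.toLinearMap ∘ₗ (D.Jsub 0 c).subtype)

/-- `A` is left multi-Koszul: the augmented left multi-Koszul complex
`⋯ → K(A)_2 → K(A)_1 → K(A)_0 → k → 0` is a projective resolution of the trivial left
`A`-module `k`. -/
structure IsLeftMultiKoszul [FiniteDimensional k V] : Prop where
  projective : ∀ i, Module.Projective D.Alg (D.KLeft i)
  surjective : Function.Surjective D.augLeft
  exact_zero : Function.Exact (D.dLeft 0) D.augLeft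
  exact_succ : ∀ i, Function.Exact (D.dLeft (i + 1)) (D.dLeft i)

end Left

section Right

/-- The map `W V^(n) → W ⊗ A`, `w v₁ ⋯ vₙ ↦ w ⊗ v₁ ⋯ vₙ`, obtained from the isomorphism
`W ⊗ V^(n) ≃ W V^(n)` given by the multiplication of `T(V)`. -/
def splitRight [FiniteDimensional k V] (n : ℕ) (W : Submodule k (TensorAlgebra k V)) :
    (W * tpow k V n : Submodule k (TensorAlgebra k V)) →ₗ[k] W ⊗[k] D.Alg :=
  LinearMap.lTensor W (D.proj.toLinearMap ∘ₗ (tpow k V n).subtype) ∘ₗ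
    (linearDisjoint_tpow_right n W).mulMap.symm.toLinearMap

/-- The module `K(A)'_i = J_i ⊗ A` of the right multi-Koszul complex. -/
abbrev KRight (i : ℕ) : Type _ := D.J i ⊗[k] D.Alg

/-- The right `A`-module structure of `J_i ⊗ A`, `(x ⊗ α) • a = x ⊗ α a`. -/
instance (i : ℕ) : Module D.Algᵐᵒᵖ (D.KRight i) :=
  Module.compHom _ ((Module.End.lTensorAlgHom k D.Alg (D.J i)).comp
    (Algebra.lsmul k k D.Alg : D.Algᵐᵒᵖ →ₐ[k] Module.End k D.Alg)).toRingHom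

theorem op_smul_tmul (i : ℕ) (a α : D.Alg) (x : D.J i) :
    MulOpposite.op a • (x ⊗ₜ[k] α : D.KRight i) = x ⊗ₜ[k] (α * a) := rfl

instance (i : ℕ) : IsScalarTower k D.Algᵐᵒᵖ (D.KRight i) where
  smul_assoc r a x := by
    change ((Module.End.lTensorAlgHom k D.Alg (D.J i)).comp
      (Algebra.lsmul k k D.Alg : D.Algᵐᵒᵖ →ₐ[k] Module.End k D.Alg)) (r • a) x =
      r • ((Module.End.lTensorAlgHom k D.Alg (D.J i)).comp
      (Algebra.lsmul k k D.Alg : D.Algᵐᵒᵖ →ₐ[k] Module.End k D.Alg)) a x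
    rw [map_smul, LinearMap.smul_apply]

/-- The right `A`-linear extension `J_i ⊗ A → N`, `x ⊗ α ↦ f(x) • α`, of a linear map `f`. -/
def liftRight {N : Type*} [AddCommMonoid N] [Module k N] [Module D.Algᵐᵒᵖ N]
    [IsScalarTower k D.Algᵐᵒᵖ N] {i : ℕ} (f : D.J i →ₗ[k] N) :
    D.KRight i →ₗ[D.Algᵐᵒᵖ] N where
  toFun := TensorProduct.lift ((((Algebra.lsmul k k N).toLinearMap ∘ₗ
    (MulOpposite.opLinearEquiv k).toLinearMap : D.Alg →ₗ[k] Module.End k N).flip) ∘ₗ f)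
  map_add' := map_add _
  map_smul' a x := by
    induction x using TensorProduct.induction_on with
    | zero => simp
    | tmul y α =>
      rw [← MulOpposite.op_unop a, op_smul_tmul]
      simp
    | add x y hx hy => rw [smul_add, map_add, hx, hy, map_add, smul_add]

/-- The differential `δ'_{i+1} : J_{i+1} ⊗ A → J_i ⊗ A` of the right multi-Koszul complex. On the
summand with index `c` it is `vₙ ⋯ v₁ ⊗ α ↦ vₙ ⋯ vₚ₊₁ ⊗ vₚ ⋯ v₁ α` with `p = letters S i c`. -/
def dRight [FiniteDimensional k V] (i : ℕ) : D.KRight (i + 1) →ₗ[D.Algᵐᵒᵖ] D.KRight i :=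
  D.liftRight (DirectSum.toModule k _ _ fun c =>
    LinearMap.rTensor D.Alg (DirectSum.lof k _ (fun c => D.Jsub i c) (target S i c)) ∘ₗ
      D.splitRight (letters S i c) (D.Jsub i (target S i c)) ∘ₗ
        Submodule.inclusion (D.Jsub_succ_le_right i c))

/-- The augmentation `δ'_0 : K(A)'_0 = V^(0) ⊗ A = A → k`, `x ⊗ α ↦ ε(x α)`. -/
def augRight : D.KRight 0 →ₗ[D.Algᵐᵒᵖ] D.Triv :=
  D.liftRight (DirectSum.toModule k _ _ fun c =>
    D.toTriv.toLinearMap ∘ₗ D.aug.toLinearMap ∘ₗ D.proj.toLinearMap ∘ₗ (D.Jsub 0 c).subtype)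

/-- `A` is right multi-Koszul: the augmented right multi-Koszul complex
`⋯ → K(A)'_2 → K(A)'_1 → K(A)'_0 → k → 0` is a projective resolution of the trivial right
`A`-module `k`. -/
structure IsRightMultiKoszul [FiniteDimensional k V] : Prop where
  projective : ∀ i, Module.Projective D.Algᵐᵒᵖ (D.KRight i)
  surjective : Function.Surjective D.augRight
  exact_zero : Function.Exact (D.dRight 0) D.augRight
  exact_succ : ∀ i, Function.Exact (D.dRight (i + 1)) (D.dRight i)

end Right

/-- The opposite `S`-multi-homogeneous algebra `A° = T(V)/⟨τ(R)⟩`, with relations `τ(R_s)`. -/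
def opposite : MultiHomogeneous k V S where
  two_le := D.two_le
  R s := (D.R s).map (rev k V)
  le_tpow s := (Submodule.map_mono (D.le_tpow s)).trans (map_rev_tpow _).le
  minimality s := by
    rw [eq_bot_iff]
    rintro x ⟨hx, hx2⟩
    obtain ⟨y, hy, rfl⟩ := hx
    have h : y ∈ D.R s ⊓ ⨆ t : S, ⨆ _ : (t : ℕ) < s, ⨆ j : Fin ((s : ℕ) - t + 1),
        tpow k V j * D.R t * tpow k V ((s : ℕ) - t - j) := by
      refine ⟨hy, ?_⟩
      have h2 := Submodule.mem_map_of_mem (f := rev k V) hx2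
      rw [rev_rev] at h2
      simp only [Submodule.map_iSup, map_rev_mul, map_rev_tpow, map_rev_map_rev] at h2
      refine SetLike.le_def.1 ?_ h2
      refine iSup_mono fun t => iSup_mono fun ht => iSup_le fun j => ?_
      have hj := j.2
      refine le_trans ?_ (le_iSup _ ⟨(s : ℕ) - t - j, by omega⟩)
      rw [← mul_assoc, show (s : ℕ) - t - ((s : ℕ) - t - j) = j by omega]
    rw [D.minimality] at h
    rw [(Submodule.mem_bot k).1 h, map_zero]
    exact zero_mem _

end MultiHomogeneous

end MultiKoszul
end

/-! The proof puts a complex of bimodules with terms A ⊗ J_i ⊗ A between the left and the right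
multi-Koszul complex. Its differential (`dBi`) moves the p letters of a differential in all ways, a
of them to the left factor and b to the right one, with a + b = p: as a difference (left minus
right) in odd degrees, where p = 1, and as a plain sum in even degrees, where p = s - 1. The
composite of two consecutive differentials telescopes to the two terms that move all s letters to
one side; these letters form a relation, so the square is zero (`biext_cutSumT`, `dBi_dBi`).

Let A be left multi-Koszul. Grade A ⊗ J_i ⊗ A by the degree in A ⊗ J_i, ignoring the last factor.
The part of the differential that preserves this degree is the left differential tensored with A
over the field k, hence exact; the other terms lower the degree. A leading-term argument
(`exact_of_exact_leading`) makes the bimodule complex, augmented to A, exact (`exact_dBi_succ`,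
`exact_dBi_zero`).

As a complex of left modules it consists of projectives and ends in A, onto which the augmentation
is split, so it splits from the right (`exists_section_dBi`). Split exactness survives k ⊗_A -,
which keeps only the terms with a = 0 and gives the right complex up to signs (`redRight_dBi`).
Hence left implies right (`isRightMultiKoszul_of_isLeftMultiKoszul`).

Reversal of words identifies the left complex of A with the right complex of A°
(`IsOpposite.isLeftMultiKoszul_iff`). Applying the implication to A° gives the converse, and the
statements on A° follow. -/

namespace MultiKoszul

/-! ### Homological algebra: split exact sequences and leading terms -/

section Homological

/-- If `im f = ker g` is split off by `t`, and the source of `g` is projective, then the image of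
`f` is covered by a section of `f`. -/
theorem exists_section_of_exact {B L M N : Type*} [Ring B] [AddCommGroup L] [AddCommGroup M]
    [AddCommGroup N] [Module B L] [Module B M] [Module B N] [Module.Projective B M]
    {f : L →ₗ[B] M} {g : M →ₗ[B] N} (hfg : Function.Exact f g) {t : N →ₗ[B] M}
    (ht : ∀ x, g (t (g x)) = g x) : ∃ s : M →ₗ[B] L, ∀ y, f (s (f y)) = f y := by
  -- The map id - t ∘ g is a projection onto ker g = im f. Its lift s along f satisfies f ∘ s = id -
  -- t ∘ g, which is the identity on im f because g ∘ f = 0.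
  have hmem : ∀ x : M, (LinearMap.id - t ∘ₗ g : M →ₗ[B] M) x ∈ LinearMap.range f := fun x =>
    (hfg _).1 (by simp [ht])
  obtain ⟨s, hs⟩ := Module.projective_lifting_property f.rangeRestrict
    ((LinearMap.id - t ∘ₗ g : M →ₗ[B] M).codRestrict (LinearMap.range f) hmem)
    f.surjective_rangeRestrict
  refine ⟨s, fun y => ?_⟩
  have h := congrArg Subtype.val (LinearMap.congr_fun hs (f y))
  simpa [hfg.apply_apply_eq_zero] using h

/-- Exactness passes to quotients `L', M', N'` of a sequence whose second map is split off by a map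
that descends to the quotients. -/
theorem exact_of_section {L M N L' M' N' : Type*} [AddCommGroup L] [AddCommGroup M]
    [AddCommGroup N] [AddCommMonoid L'] [AddCommMonoid M'] [AddCommMonoid N']
    {f : L →+ M} {g : M →+ N} (hfg : Function.Exact f g) {t : N →+ M}
    (ht : ∀ x, g (t (g x)) = g x) {f' : L' →+ M'} {g' : M' →+ N'} {qL : L →+ L'}
    {qM : M →+ M'} {qN : N →+ N'} (hqL : Function.Surjective qL) (hqM : Function.Surjective qM)
    (hf : ∀ x, qM (f x) = f' (qL x)) (hg : ∀ x, qN (g x) = g' (qM x))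
    {h : N' →+ M'} (hh : ∀ z, qM (t z) = h (qN z)) : Function.Exact f' g' := by
  intro x'
  constructor
  · obtain ⟨x, rfl⟩ := hqM x'
    intro hx
    -- A lift x of a cycle need not be a cycle. The correction t (g x) makes it one and vanishes in
    -- M', since its class is h applied to g' (qM x) = 0.
    obtain ⟨y, hy⟩ := (hfg (x - t (g x))).1 (by simp [ht])
    refine ⟨qL y, ?_⟩
    rw [← hf, ← add_zero (qM (f y)), ← map_zero h, ← hx, ← hg, ← hh, ← map_add, hy,
      sub_add_cancel]
  · rintro ⟨y', rfl⟩
    obtain ⟨y, rfl⟩ := hqL y'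
    rw [← hf, ← hg, hfg.apply_apply_eq_zero, map_zero]

/-- A sequence `L → M → N` of graded groups is exact if it is a complex and the parts of
degree `0` of its maps form an exact sequence, all other parts being of negative degree. Here the
grading is given by the projections to the homogeneous components. -/
theorem exact_of_exact_leading {L M N : Type*} [AddCommGroup L] [AddCommGroup M]
    [AddCommGroup N] {PL : ℕ → L →+ L} {PM : ℕ → M →+ M} {PN : ℕ → N →+ N}
    (hPP : ∀ m n x, PM n (PM m x) = if n = m then PM m x else 0)
    (hP : ∀ x, ∃ m, ∑ n ∈ Finset.range m, PM n x = x)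
    {d d0 : L →+ M} {d' d0' : M →+ N} (hd : ∀ y, d' (d y) = 0)
    (h0 : ∀ x, d0' x = 0 → ∃ y, d0 y = x)
    (hc : ∀ n y, d0 (PL n y) = PM n (d0 y)) (hc' : ∀ n x, d0' (PM n x) = PN n (d0' x))
    (he : ∀ m n y, m ≤ n → PM n (d (PL m y) - d0 (PL m y)) = 0)
    (he' : ∀ m n x, m ≤ n → PN n (d' (PM m x) - d0' (PM m x)) = 0) :
    Function.Exact d d' := by
  -- Induction on a strict bound m for the degrees that occur in x: a boundary is subtracted to
  -- remove the top component.
  have key : ∀ m x, (∀ n, m ≤ n → PM n x = 0) → d' x = 0 → ∃ y, d y = x := by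
    intro m
    induction m with
    | zero =>
      intro x hx _
      obtain ⟨m, hm⟩ := hP x
      refine ⟨0, ?_⟩
      rw [map_zero, ← hm, Finset.sum_eq_zero fun n _ => hx n (Nat.zero_le n)]
    | succ m ih =>
      intro x hx hdx
      -- Components of x below degree m cannot reach degree m under d' - d0', and the one in degree
      -- m only drops. So d0' of the top component is the degree m part of d' x = 0.
      have h1 : PN m (d' x - d0' x) = 0 := by
        obtain ⟨l, hl⟩ := hP x
        rw [← hl, map_sum, map_sum, ← Finset.sum_sub_distrib, map_sum]
        refine Finset.sum_eq_zero fun n _ => ?_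
        rcases Nat.lt_or_ge m n with hmn | hmn
        · rw [hx n hmn]; simp
        · exact he' n m x hmn
      have h2 : d0' (PM m x) = 0 := by
        rw [hc']
        simpa [hdx] using h1
      obtain ⟨y, hy⟩ := h0 _ h2
      -- Only the degree m part of y is used: d0 still sends it to the top component, and now d - d0
      -- sends it strictly below degree m.
      have h3 : d0 (PL m y) = PM m x := by rw [hc, hy, hPP, if_pos rfl]
      have h5 : ∀ n, m ≤ n → PM n (x - d (PL m y)) = 0 := by
        intro n hn
        have h4 := he m n y hn
        rw [map_sub, sub_eq_zero, h3, hPP] at h4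
        rw [map_sub, h4]
        rcases hn.eq_or_lt with rfl | hn'
        · simp
        · rw [hx n hn', if_neg hn'.ne', sub_zero]
      obtain ⟨z, hz⟩ := ih (x - d (PL m y)) h5 (by rw [map_sub, hdx, hd, sub_zero])
      exact ⟨z + PL m y, by rw [map_add, hz, sub_add_cancel]⟩
  intro x
  constructor
  · intro hx
    obtain ⟨m, hm⟩ := hP x
    refine key m x (fun n hn => ?_) hx
    rw [← hm, map_sum]
    refine Finset.sum_eq_zero fun l hl => ?_
    rw [hPP, if_neg (by have := Finset.mem_range.1 hl; omega)]
  · rintro ⟨y, rfl⟩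
    exact hd y

end Homological

/-! ### Free bimodules B ⊗ X ⊗ B and their homomorphisms -/

section Bimodule

variable {k B X Y : Type*} [Field k] [Ring B] [Algebra k B] [AddCommMonoid X] [Module k X]
  [AddCommMonoid Y] [Module k Y]

/-- The multiplication `(B ⊗ Y ⊗ B) → (B ⊗ Y ⊗ B)` by `α` from the left and by `β` from the
right. -/
def bimul (k : Type*) {B : Type*} (Y : Type*) [Field k] [Ring B] [Algebra k B] [AddCommMonoid Y]
    [Module k Y] (α β : B) : Module.End k ((B ⊗[k] Y) ⊗[k] B) :=
  TensorProduct.map (LinearMap.rTensor Y (LinearMap.mulLeft k α)) (LinearMap.mulRight k β)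

@[simp]
theorem bimul_tmul (α β α' β' : B) (y : Y) :
    bimul k Y α β ((α' ⊗ₜ y) ⊗ₜ β') = ((α * α') ⊗ₜ y) ⊗ₜ (β' * β) := by
  simp [bimul]

theorem bimul_bimul (α β α' β' : B) (z : (B ⊗[k] Y) ⊗[k] B) :
    bimul k Y α β (bimul k Y α' β' z) = bimul k Y (α * α') (β' * β) z := by
  have : bimul k Y α β ∘ₗ bimul k Y α' β' = bimul k Y (α * α') (β' * β) := by
    ext; simp [mul_assoc]
  exact LinearMap.congr_fun this z

theorem smul_bimul (a α β : B) (z : (B ⊗[k] Y) ⊗[k] B) :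
    a • bimul k Y α β z = bimul k Y (a * α) β z := by
  have : Algebra.lsmul k k _ a ∘ₗ bimul k Y α β = bimul k Y (a * α) β := by
    ext; simp [mul_assoc, TensorProduct.smul_tmul']
  exact LinearMap.congr_fun this z

/-- `bimul` as a bilinear map. -/
def bimulₗ (k B Y : Type*) [Field k] [Ring B] [Algebra k B] [AddCommMonoid Y] [Module k Y] :
    B →ₗ[k] B →ₗ[k] Module.End k ((B ⊗[k] Y) ⊗[k] B) :=
  LinearMap.mk₂ k (bimul k Y)
    (fun a b c => by ext; simp [add_mul, TensorProduct.add_tmul])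
    (fun r a c => by ext; simp [TensorProduct.smul_tmul'])
    (fun a b c => by ext; simp [mul_add, TensorProduct.tmul_add])
    (fun r a c => by ext; simp)

/-- The linear map `α ⊗ x ⊗ β ↦ b(α, β)(f(x))`. -/
def liftAct {M : Type*} [AddCommMonoid M] [Module k M] (b : B →ₗ[k] B →ₗ[k] Module.End k M)
    (f : X →ₗ[k] M) : (B ⊗[k] X) ⊗[k] B →ₗ[k] M :=
  TensorProduct.lift (TensorProduct.lift (LinearMap.mk₂ k (fun α x => (b α).flip (f x))
    (fun _ _ _ => by ext; simp) (fun _ _ _ => by ext; simp)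
    (fun _ _ _ => by ext; simp) (fun _ _ _ => by ext; simp)))

theorem liftAct_tmul {M : Type*} [AddCommMonoid M] [Module k M]
    (b : B →ₗ[k] B →ₗ[k] Module.End k M) (f : X →ₗ[k] M) (α β : B) (x : X) :
    liftAct b f ((α ⊗ₜ x) ⊗ₜ β) = b α β (f x) := rfl

theorem liftAct_smul {M : Type*} [AddCommMonoid M] [Module k M] [Module B M]
    (b : B →ₗ[k] B →ₗ[k] Module.End k M) (hb : ∀ a α β m, b (a * α) β m = a • b α β m)
    (f : X →ₗ[k] M) (a : B) (z : (B ⊗[k] X) ⊗[k] B) :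
    liftAct b f (a • z) = a • liftAct b f z := by
  induction z using TensorProduct.induction_on with
  | zero => simp
  | add x y hx hy => rw [smul_add, map_add, hx, hy, map_add, smul_add]
  | tmul x β =>
    induction x using TensorProduct.induction_on with
    | zero => simp
    | add x y hx hy => rw [TensorProduct.add_tmul, smul_add, map_add, hx, hy, map_add, smul_add]
    | tmul α x =>
      rw [TensorProduct.smul_tmul', TensorProduct.smul_tmul', liftAct_tmul, liftAct_tmul,
        smul_eq_mul, hb]

/-- The extension of a linear map `X → B ⊗ Y ⊗ B` to a homomorphism
`B ⊗ X ⊗ B → B ⊗ Y ⊗ B` of bimodules; it is recorded as a homomorphism of left modules. -/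
def biext (f : X →ₗ[k] (B ⊗[k] Y) ⊗[k] B) : (B ⊗[k] X) ⊗[k] B →ₗ[B] (B ⊗[k] Y) ⊗[k] B where
  toFun z := liftAct (bimulₗ k B Y) f z
  map_add' x y := LinearMap.map_add (liftAct (bimulₗ k B Y) f) x y
  map_smul' a z := liftAct_smul (bimulₗ k B Y) (fun a α β m => (smul_bimul a α β m).symm) f a z

@[simp]
theorem biext_tmul (f : X →ₗ[k] (B ⊗[k] Y) ⊗[k] B) (α β : B) (x : X) :
    biext f ((α ⊗ₜ x) ⊗ₜ β) = bimul k Y α β (f x) := rfl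

theorem biext_bimul (f : X →ₗ[k] (B ⊗[k] Y) ⊗[k] B) (α β : B) (z : (B ⊗[k] X) ⊗[k] B) :
    biext f (bimul k X α β z) = bimul k Y α β (biext f z) := by
  have : (biext f).restrictScalars k ∘ₗ bimul k X α β =
      bimul k Y α β ∘ₗ (biext f).restrictScalars k := by
    ext; simp [bimul_bimul]
  exact LinearMap.congr_fun this z

/-- The multiplication of `B` by elements from the left and from the right. -/
def mulMul (k B : Type*) [Field k] [Ring B] [Algebra k B] : B →ₗ[k] B →ₗ[k] Module.End k B :=
  LinearMap.mk₂ k (fun α β => LinearMap.mulLeft k α ∘ₗ LinearMap.mulRight k β)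
    (fun _ _ _ => by ext; simp [add_mul]) (fun _ _ _ => by ext; simp)
    (fun _ _ _ => by ext; simp [mul_add]) (fun _ _ _ => by ext; simp)

/-- The extension of a linear map `X → B` to a homomorphism `B ⊗ X ⊗ B → B` of bimodules; it is
recorded as a homomorphism of left modules. -/
def bimulExt (f : X →ₗ[k] B) : (B ⊗[k] X) ⊗[k] B →ₗ[B] B where
  toFun z := liftAct (mulMul k B) f z
  map_add' x y := LinearMap.map_add (liftAct (mulMul k B) f) x y
  map_smul' a z := liftAct_smul (mulMul k B) (fun a α β m => by simp [mulMul]) f a z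

theorem bimulExt_tmul (f : X →ₗ[k] B) (α β : B) (x : X) :
    bimulExt f ((α ⊗ₜ x) ⊗ₜ β) = α * (f x * β) := rfl

/-- The map `B ⊗ X ⊗ B → B ⊗ Y ⊗ B` induced by a linear map `X → Y`. -/
def bimap (B : Type*) [Ring B] [Algebra k B] (f : X →ₗ[k] Y) :
    (B ⊗[k] X) ⊗[k] B →ₗ[k] (B ⊗[k] Y) ⊗[k] B :=
  LinearMap.rTensor B (LinearMap.lTensor B f)

@[simp]
theorem bimap_tmul (f : X →ₗ[k] Y) (α β : B) (x : X) :
    bimap B f ((α ⊗ₜ x) ⊗ₜ β) = (α ⊗ₜ f x) ⊗ₜ β := rfl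

theorem bimap_bimul (f : X →ₗ[k] Y) (α β : B) (z : (B ⊗[k] X) ⊗[k] B) :
    bimap B f (bimul k X α β z) = bimul k Y α β (bimap B f z) := by
  have : bimap B f ∘ₗ bimul k X α β = bimul k Y α β ∘ₗ bimap B f := by
    ext; simp
  exact LinearMap.congr_fun this z

/-- Modules over a field are flat. This allows identities in B ⊗ W ⊗ B, for W ⊆ T(V), to be checked
in B ⊗ T(V) ⊗ B. -/
theorem bimap_injective {f : X →ₗ[k] Y} (hf : Function.Injective f) :
    Function.Injective (bimap B f) :=
  Module.Flat.rTensor_preserves_injective_linearMap _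
    (Module.Flat.lTensor_preserves_injective_linearMap _ hf)

/-- Naturality of the bimodule extension. -/
theorem bimap_biext {X' Y' : Type*} [AddCommMonoid X'] [Module k X'] [AddCommMonoid Y']
    [Module k Y']
    {f : X →ₗ[k] (B ⊗[k] Y) ⊗[k] B} {f' : X' →ₗ[k] (B ⊗[k] Y') ⊗[k] B}
    {g : X →ₗ[k] X'} {h : Y →ₗ[k] Y'} (hfg : ∀ x, bimap B h (f x) = f' (g x))
    (z : (B ⊗[k] X) ⊗[k] B) : bimap B h (biext f z) = biext f' (bimap B g z) := by
  have : bimap B h ∘ₗ (biext f).restrictScalars k = (biext f').restrictScalars k ∘ₗ bimap B g := by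
    ext; simp [bimap_bimul, hfg]
  exact LinearMap.congr_fun this z

end Bimodule

end MultiKoszul

namespace MultiKoszul

/-! ### Moving letters out of both ends of a word -/

section Cut

theorem mul_mul_induction {R A : Type*} [CommSemiring R] [Semiring A] [Algebra R A]
    {M N P : Submodule R A} {C : A → Prop}
    (hm : ∀ u ∈ M, ∀ w ∈ N, ∀ u' ∈ P, C (u * w * u')) (ha : ∀ x y, C x → C y → C (x + y)) {x : A}
    (hx : x ∈ M * N * P) : C x := by
  refine Submodule.mul_induction_on hx (fun m hm' n hn => ?_) ha
  refine Submodule.mul_induction_on hm' (fun u hu w hw => hm u hu w hw n hn) fun y z hy hz => ?_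
  rw [add_mul]
  exact ha _ _ hy hz

theorem one_mem_tpow {k V : Type*} [Field k] [AddCommGroup V] [Module k V] :
    (1 : TensorAlgebra k V) ∈ tpow k V 0 :=
  Submodule.mem_one.2 ⟨1, map_one _⟩

variable {k V B : Type*} [Field k] [AddCommGroup V] [Module k V] [FiniteDimensional k V]
  [Ring B] [Algebra k B] (π : TensorAlgebra k V →ₐ[k] B)

/-- The multiplication V^(a) ⊗ W ⊗ V^(b) → T(V) is injective by two applications of linear
disjointness, so words in its image can be cut uniquely. -/
theorem exists_cut (a b : ℕ) (W : Submodule k (TensorAlgebra k V)) :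
    ∃ c : TensorAlgebra k V →ₗ[k] (B ⊗[k] W) ⊗[k] B, ∀ u ∈ tpow k V a, ∀ w : W,
      ∀ u' ∈ tpow k V b, c (u * w * u') = (π u ⊗ₜ w) ⊗ₜ π u' := by
  let e := (linearDisjoint_tpow_right b (tpow k V a * W)).mulMap
  let e' := (linearDisjoint_tpow_left a W).mulMap
  let f : (tpow k V a * W * tpow k V b : Submodule k _) →ₗ[k] (B ⊗[k] W) ⊗[k] B :=
    TensorProduct.map
      (LinearMap.rTensor W (π.toLinearMap ∘ₗ (tpow k V a).subtype) ∘ₗ e'.symm.toLinearMap)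
      (π.toLinearMap ∘ₗ (tpow k V b).subtype) ∘ₗ e.symm.toLinearMap
  -- The values outside V^(a) W V^(b) are arbitrary. The extension gives all cuts the common domain
  -- T(V), so that those with a + b = p can be added.
  obtain ⟨c, hc⟩ := LinearMap.exists_extend (V' := (B ⊗[k] W) ⊗[k] B) f
  refine ⟨c, fun u hu w u' hu' => ?_⟩
  have h1 : e' (⟨u, hu⟩ ⊗ₜ w) = ⟨u * w, Submodule.mul_mem_mul hu w.2⟩ := rfl
  have h2 : e (⟨u * w, Submodule.mul_mem_mul hu w.2⟩ ⊗ₜ ⟨u', hu'⟩) =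
    ⟨u * w * u', Submodule.mul_mem_mul (Submodule.mul_mem_mul hu w.2) hu'⟩ := rfl
  have h3 := LinearMap.congr_fun hc
    ⟨u * w * u', Submodule.mul_mem_mul (Submodule.mul_mem_mul hu w.2) hu'⟩
  rw [← h2] at h3
  simp only [f, ← h1, LinearMap.comp_apply, LinearEquiv.coe_coe, LinearEquiv.symm_apply_apply,
    TensorProduct.map_tmul, LinearMap.rTensor_tmul] at h3
  exact h3

/-- A linear map on `T(V)` which on `V^(a) W V^(b)` is `u w u' ↦ u ⊗ w ⊗ u'`. -/
noncomputable def cut (a b : ℕ) (W : Submodule k (TensorAlgebra k V)) :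
    TensorAlgebra k V →ₗ[k] (B ⊗[k] W) ⊗[k] B :=
  (exists_cut π a b W).choose

theorem cut_mul {a b : ℕ} {W : Submodule k (TensorAlgebra k V)} {u w u' : TensorAlgebra k V}
    (hu : u ∈ tpow k V a) (hw : w ∈ W) (hu' : u' ∈ tpow k V b) :
    cut π a b W (u * w * u') = (π u ⊗ₜ ⟨w, hw⟩) ⊗ₜ π u' :=
  (exists_cut π a b W).choose_spec u hu ⟨w, hw⟩ u' hu'

/-- A linear map on `T(V)` which on `V^(a) T(V) V^(b)` is `u y u' ↦ u ⊗ y ⊗ u'`. -/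
noncomputable def cutT (a b : ℕ) :
    TensorAlgebra k V →ₗ[k] (B ⊗[k] TensorAlgebra k V) ⊗[k] B :=
  bimap B (Submodule.subtype ⊤) ∘ₗ cut π a b ⊤

theorem cutT_mul {a b : ℕ} {u u' : TensorAlgebra k V} (hu : u ∈ tpow k V a)
    (w : TensorAlgebra k V) (hu' : u' ∈ tpow k V b) :
    cutT π a b (u * w * u') = (π u ⊗ₜ w) ⊗ₜ π u' := by
  rw [cutT, LinearMap.comp_apply, cut_mul π hu (Submodule.mem_top (x := w)) hu', bimap_tmul]
  rfl

theorem bimap_cut {a b : ℕ} {W : Submodule k (TensorAlgebra k V)} {x : TensorAlgebra k V}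
    (hx : x ∈ tpow k V a * W * tpow k V b) :
    bimap B W.subtype (cut π a b W x) = cutT π a b x := by
  refine mul_mul_induction (C := fun x => bimap B W.subtype (cut π a b W x) = cutT π a b x)
    (fun u hu w hw u' hu' => ?_) (fun x y hx hy => ?_) hx
  · rw [cut_mul π hu hw hu', cutT_mul π hu w hu', bimap_tmul, Submodule.subtype_apply]
  · rw [map_add, map_add, map_add, hx, hy]

/-- Letters cut off in the second step stand inside those cut off in the first. On the left they are
appended, on the right prepended, whence the order b' + b. -/
theorem biext_cutT {a b a' b' : ℕ} {x : TensorAlgebra k V}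
    (hx : x ∈ tpow k V a * (tpow k V a' * ⊤ * tpow k V b') * tpow k V b) :
    biext (cutT π a' b') (cutT π a b x) = cutT π (a + a') (b' + b) x := by
  refine mul_mul_induction (C := fun x => biext (cutT π a' b') (cutT π a b x) =
    cutT π (a + a') (b' + b) x) (fun u hu y hy u' hu' => ?_) (fun x y hx hy => ?_) hx
  · refine mul_mul_induction (C := fun y => biext (cutT π a' b') (cutT π a b (u * y * u')) =
      cutT π (a + a') (b' + b) (u * y * u')) (fun v hv w _ v' hv' => ?_) (fun x y hx hy => ?_) hy
    · rw [cutT_mul π hu _ hu', biext_tmul, cutT_mul π hv _ hv', bimul_tmul,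
        show u * (v * w * v') * u' = (u * v) * w * (v' * u') by simp only [mul_assoc],
        cutT_mul π (tpow_add (k := k) (V := V) a a' ▸ Submodule.mul_mem_mul hu hv) _
          (tpow_add (k := k) (V := V) b' b ▸ Submodule.mul_mem_mul hv' hu'), map_mul, map_mul]
    · rw [mul_add, add_mul, map_add, map_add, map_add, hx, hy]
  · rw [map_add, map_add, map_add, hx, hy]

/-- The q letters cut off form a relation, which π kills. Together with the mirror statement this
disposes of the two end terms of the telescoping sum. -/
theorem cutT_eq_zero_of_mem_left {q : ℕ} {R : Submodule k (TensorAlgebra k V)}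
    (hR : R ≤ tpow k V q) (hπ : ∀ r ∈ R, π r = 0) {x : TensorAlgebra k V} (hx : x ∈ R * ⊤) :
    cutT π q 0 x = 0 := by
  refine Submodule.mul_induction_on hx (fun r hr y _ => ?_) fun y z hy hz => ?_
  · rw [← mul_one (r * y), cutT_mul π (hR hr) y one_mem_tpow, hπ r hr, TensorProduct.zero_tmul, TensorProduct.zero_tmul]
  · rw [map_add, hy, hz, add_zero]

theorem cutT_eq_zero_of_mem_right {q : ℕ} {R : Submodule k (TensorAlgebra k V)}
    (hR : R ≤ tpow k V q) (hπ : ∀ r ∈ R, π r = 0) {x : TensorAlgebra k V} (hx : x ∈ ⊤ * R) :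
    cutT π 0 q x = 0 := by
  refine Submodule.mul_induction_on hx (fun y _ r hr => ?_) fun y z hy hz => ?_
  · rw [← one_mul y, cutT_mul π one_mem_tpow y (hR hr),
      hπ r hr, TensorProduct.tmul_zero]
  · rw [map_add, hy, hz, add_zero]

/-- The linear combination `∑_{a + b = p} σ^b (u w u' ↦ u ⊗ w ⊗ u')` of the maps that move
`a` letters to the left and `b` letters to the right. -/
noncomputable def cutSum (p : ℕ) (σ : k) (W : Submodule k (TensorAlgebra k V)) :
    TensorAlgebra k V →ₗ[k] (B ⊗[k] W) ⊗[k] B :=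
  ∑ q ∈ Finset.HasAntidiagonal.antidiagonal p, σ ^ q.2 • cut π q.1 q.2 W

/-- The analogue of `cutSum` with values in `B ⊗ T(V) ⊗ B`. -/
noncomputable def cutSumT (p : ℕ) (σ : k) :
    TensorAlgebra k V →ₗ[k] (B ⊗[k] TensorAlgebra k V) ⊗[k] B :=
  ∑ q ∈ Finset.HasAntidiagonal.antidiagonal p, σ ^ q.2 • cutT π q.1 q.2

theorem cutSum_apply (p : ℕ) (σ : k) (W : Submodule k (TensorAlgebra k V))
    (x : TensorAlgebra k V) :
    cutSum π p σ W x = ∑ q ∈ Finset.HasAntidiagonal.antidiagonal p, σ ^ q.2 • cut π q.1 q.2 W x := by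
  simp [cutSum]

theorem cutSumT_apply (p : ℕ) (σ : k) (x : TensorAlgebra k V) :
    cutSumT π p σ x = ∑ q ∈ Finset.HasAntidiagonal.antidiagonal p, σ ^ q.2 • cutT π q.1 q.2 x := by
  simp [cutSumT]

theorem bimap_cutSum {p : ℕ} {σ : k} {W : Submodule k (TensorAlgebra k V)}
    {x : TensorAlgebra k V}
    (hx : ∀ q ∈ Finset.HasAntidiagonal.antidiagonal p, x ∈ tpow k V q.1 * W * tpow k V q.2) :
    bimap B W.subtype (cutSum π p σ W x) = cutSumT π p σ x := by
  rw [cutSum_apply, cutSumT_apply, map_sum]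
  exact Finset.sum_congr rfl fun q hq => by rw [map_smul, bimap_cut π (hx q hq)]

/-- One of the two maps is the difference of the cuts (1, 0) and (0, 1), the other the sum of all
cuts with a + b fixed. Their composite is a telescoping sum of cuts of p + p' letters, whose end
terms vanish by `hl` and `hr`. -/
theorem biext_cutSumT {p p' : ℕ} {σ σ' : k}
    (hσ : p = 1 ∧ σ = -1 ∧ σ' = 1 ∨ p' = 1 ∧ σ = 1 ∧ σ' = -1)
    {x : TensorAlgebra k V}
    (hx : ∀ q ∈ Finset.HasAntidiagonal.antidiagonal p,
      ∀ q' ∈ Finset.HasAntidiagonal.antidiagonal p',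
        x ∈ tpow k V q.1 * (tpow k V q'.1 * ⊤ * tpow k V q'.2) * tpow k V q.2)
    (hl : cutT π (p + p') 0 x = 0) (hr : cutT π 0 (p + p') x = 0) :
    biext (cutSumT π p' σ') (cutSumT π p σ x) = 0 := by
  have h : biext (cutSumT π p' σ') (cutSumT π p σ x) =
      ∑ q ∈ Finset.HasAntidiagonal.antidiagonal p, ∑ q' ∈ Finset.HasAntidiagonal.antidiagonal p',
        (σ ^ q.2 * σ' ^ q'.2) • cutT π (q.1 + q'.1) (q'.2 + q.2) x := by
    rw [cutSumT_apply, map_sum]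
    refine Finset.sum_congr rfl fun q hq => ?_
    have h2 : ∀ z, biext (cutSumT π p' σ') z =
        ∑ q' ∈ Finset.HasAntidiagonal.antidiagonal p', σ' ^ q'.2 • biext (cutT π q'.1 q'.2) z := by
      intro z
      induction z using TensorProduct.induction_on with
      | zero => simp
      | add x y hx hy => simp only [map_add, hx, hy, smul_add, Finset.sum_add_distrib]
      | tmul z β =>
        induction z using TensorProduct.induction_on with
        | zero => simp
        | add x y hx hy =>
          simp only [TensorProduct.add_tmul, map_add, hx, hy, smul_add, Finset.sum_add_distrib]
        | tmul α z => simp [cutSumT_apply]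
    rw [h2]
    refine Finset.sum_congr rfl fun q' hq' => ?_
    rw [LinearMap.map_smul_of_tower, biext_cutT π (hx q hq q' hq'), smul_smul, mul_comm]
  -- The sum of f over the antidiagonal of n + 1 is split once at its first and once at its last
  -- term.
  have tel : ∀ (n : ℕ) (f : ℕ → ℕ → (B ⊗[k] TensorAlgebra k V) ⊗[k] B), f (n + 1) 0 = 0 →
      f 0 (n + 1) = 0 → ∑ q ∈ Finset.HasAntidiagonal.antidiagonal n, f (q.1 + 1) q.2 =
        ∑ q ∈ Finset.HasAntidiagonal.antidiagonal n, f q.1 (q.2 + 1) := by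
    intro n f h1 h2
    have h3 := Finset.Nat.sum_antidiagonal_succ (n := n) (f := fun q => f q.1 q.2)
    rw [Finset.Nat.sum_antidiagonal_succ'] at h3
    simpa [h1, h2] using h3.symm
  rw [h]
  rcases hσ with ⟨rfl, rfl, rfl⟩ | ⟨rfl, rfl, rfl⟩
  · rw [add_comm] at hl hr
    have h4 := tel p' (fun a b => cutT π a b x) hl hr
    simp [Finset.Nat.antidiagonal_succ, add_comm 1, h4, ← Finset.smul_sum]
  · have h4 := tel p (fun a b => cutT π a b x) hl hr
    simp [Finset.Nat.antidiagonal_succ, Finset.sum_add_distrib, add_comm 1, h4, ← Finset.smul_sum]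

/-- The two maps `cutSum` that form the bimodule complex compose to zero. -/
theorem biext_cutSum {p p' : ℕ} {σ σ' : k}
    (hσ : p = 1 ∧ σ = -1 ∧ σ' = 1 ∨ p' = 1 ∧ σ = 1 ∧ σ' = -1)
    {W W' : Submodule k (TensorAlgebra k V)} {x : TensorAlgebra k V}
    (hx : ∀ q ∈ Finset.HasAntidiagonal.antidiagonal p, x ∈ tpow k V q.1 * W * tpow k V q.2)
    (hW : ∀ q ∈ Finset.HasAntidiagonal.antidiagonal p', W ≤ tpow k V q.1 * W' * tpow k V q.2)
    (hl : cutT π (p + p') 0 x = 0) (hr : cutT π 0 (p + p') x = 0) :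
    biext (cutSum π p' σ' W' ∘ₗ W.subtype) (cutSum π p σ W x) = 0 := by
  -- In B ⊗ T(V) ⊗ B cuts compose without reference to W and W'.
  apply bimap_injective W'.injective_subtype
  rw [map_zero, bimap_biext (f' := cutSumT π p' σ') (g := W.subtype)
    (fun y => bimap_cutSum π fun q hq => hW q hq y.2), bimap_cutSum π hx]
  refine biext_cutSumT π hσ (fun q hq q' hq' => SetLike.le_def.1 ?_ (hx q hq)) hl hr
  exact mul_le_mul_left (mul_le_mul_right ((hW q' hq').trans
    (mul_le_mul_left (mul_le_mul_right le_top _) _)) _) _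

end Cut
end MultiKoszul

/-! ### Degrees of the spaces J_i and two-sided inclusions between them -/

noncomputable section

namespace MultiKoszul

/-- Of the conditions that define the left side, those at positions a + j with 0 ≤ j ≤ n_s(i+2) - s
have the common outer factors V^(a) and V^(b). Taking these out of the intersection leaves
J_{i+2}^s. -/
theorem Jpow_succ_le {k V : Type*} [Field k] [AddCommGroup V] [Module k V] [FiniteDimensional k V]
    (M : Submodule k (TensorAlgebra k V)) {s : ℕ} (hs : 2 ≤ s) (i : ℕ) {a b : ℕ}
    (hab : a + b = moved s (i + 3)) :
    Jpow M s (i + 3) ≤ tpow k V a * Jpow M s (i + 2) * tpow k V b := by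
  refine le_trans (le_trans ?_ (iInf_mul_tpow_le b fun j : Fin (nfun s (i + 2) - s + 1) =>
    tpow k V a * (tpow k V j * M * tpow k V (nfun s (i + 2) - s - j))))
    (mul_le_mul_left (iInf_tpow_mul_le _ _) _)
  have h : nfun s (i + 3) = nfun s (i + 2) + moved s (i + 3) := nfun_succ hs (i + 2)
  have h2 := le_nfun s i
  refine le_iInf fun j => ?_
  have hj := j.2
  refine le_trans (iInf_le _ ⟨a + j, by omega⟩) ?_
  rw [← mul_assoc, ← mul_assoc, ← tpow_add, mul_assoc _ _ (tpow k V b), ← tpow_add,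
    show nfun s (i + 3) - s - (a + j) = nfun s (i + 2) - s - j + b by omega]

/-- The degree of a summand of `J_i`. -/
def degree (S : Finset ℕ) : (i : ℕ) → Idx S i → ℕ
  | 0, _ => 0
  | 1, _ => 1
  | i + 2, s => nfun (Subtype.val (p := (· ∈ S)) s) (i + 2)

/-- This makes the left differential homogeneous of degree 0: the letters lost by J are gained by A.
-/
theorem degree_succ {S : Finset ℕ} (hS : ∀ s ∈ S, 2 ≤ s) : ∀ (i : ℕ) (c : Idx S (i + 1)),
    degree S (i + 1) c = letters S i c + degree S i (target S i c)
  | 0, _ => rfl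
  | 1, s => by
    have h2 := hS _ (Subtype.prop (p := (· ∈ S)) s)
    have h := nfun_succ h2 1
    change nfun (Subtype.val (p := (· ∈ S)) s) 2 = moved (Subtype.val (p := (· ∈ S)) s) 2 + 1
    rw [h, show nfun (Subtype.val (p := (· ∈ S)) s) 1 = 1 from by simp [nfun], add_comm]
  | i + 2, s => by
    have h2 := hS _ (Subtype.prop (p := (· ∈ S)) s)
    exact (nfun_succ h2 (i + 2)).trans (add_comm _ _)

/-- One of two consecutive differentials moves 1 letter and the other s - 1, together the length of
a relation in R_s. This is the source of d² = 0. -/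
theorem letters_add_letters {S : Finset ℕ} (hS : ∀ s ∈ S, 2 ≤ s) : ∀ (i : ℕ) (c : Idx S (i + 2)),
    letters S (i + 1) c + letters S i (target S (i + 1) c) = Subtype.val (p := (· ∈ S)) c
  | 0, s => by
    have h2 := hS _ (Subtype.prop (p := (· ∈ S)) s)
    simp only [letters, moved]
    simp
    omega
  | i + 1, s => by
    have h2 := hS _ (Subtype.prop (p := (· ∈ S)) s)
    simp only [letters, moved, target]
    rcases Nat.even_or_odd i with h | h
    · have h' : ¬ Even (i + 1) := by rw [Nat.even_add_one]; exact not_not.2 h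
      simp [h', Nat.even_add_one, add_assoc]
      omega
    · have h' := Nat.not_even_iff_odd.2 h
      simp [h', Nat.even_add_one]
      omega

/-- These are the differentials of odd index i + 1, exactly those in which the sign (-1)^(i+1) is
-1. -/
theorem letters_eq_one {S : Finset ℕ} : ∀ (i : ℕ) (c : Idx S (i + 1)), Even i → letters S i c = 1
  | 0, _, _ => rfl
  | i + 1, s, h => by
    have h' : ¬ Even i := by rwa [Nat.even_add_one] at h
    simp [letters, moved, Nat.even_add, h']

namespace MultiHomogeneous

variable {k V : Type*} [Field k] [AddCommGroup V] [Module k V] {S : Finset ℕ}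
  (D : MultiHomogeneous k V S)

theorem proj_eq_zero (s : S) {r : TensorAlgebra k V} (hr : r ∈ D.R s) : D.proj r = 0 :=
  Ideal.Quotient.eq_zero_iff_mem.2 (TwoSidedIdeal.subset_span (Set.mem_iUnion.2 ⟨s, hr⟩))

theorem Jsub_succ_le [FiniteDimensional k V] : ∀ (i : ℕ) (c : Idx S (i + 1)) {a b : ℕ},
    a + b = letters S i c →
    D.Jsub (i + 1) c ≤ tpow k V a * D.Jsub i (target S i c) * tpow k V b
  | 0, _, a, b, h => by
    change a + b = 1 at h
    change tpow k V 1 ≤ tpow k V a * tpow k V 0 * tpow k V b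
    rw [← tpow_add, ← tpow_add, add_zero, h]
  | 1, s, a, b, h => by
    change a + b = moved (Subtype.val (p := (· ∈ S)) s) 2 at h
    have h2 := D.two_le _ (Subtype.prop (p := (· ∈ S)) s)
    have h3 : moved (Subtype.val (p := (· ∈ S)) s) 2 + 1 = Subtype.val (p := (· ∈ S)) s := by
      simp [moved]; omega
    change Jpow (D.R s) (Subtype.val (p := (· ∈ S)) s) 2 ≤ tpow k V a * tpow k V 1 * tpow k V b
    rw [Jpow_two, ← tpow_add, ← tpow_add, show a + 1 + b = Subtype.val (p := (· ∈ S)) s by omega]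
    exact D.le_tpow s
  | i + 2, s, _, _, h => Jpow_succ_le _ (D.two_le _ (Subtype.prop (p := (· ∈ S)) s)) i h

/-- This is the condition at position j = 0; the next lemma uses the last position. -/
theorem Jsub_le_R_mul (i : ℕ) (s : S) : D.Jsub (i + 2) s ≤ D.R s * ⊤ := by
  refine (iInf_le _ 0).trans ?_
  rw [Fin.val_zero, tpow_zero, one_mul]
  exact mul_le_mul_right le_top _

theorem Jsub_le_mul_R (i : ℕ) (s : S) : D.Jsub (i + 2) s ≤ ⊤ * D.R s := by
  refine (iInf_le _ (Fin.last _)).trans ?_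
  rw [Fin.val_last, Nat.sub_self, tpow_zero, mul_one]
  exact mul_le_mul_left le_top _

/-! ### The multi-Koszul bimodule complex -/

section Complex

/-- The module `A ⊗ J_i ⊗ A` of the multi-Koszul bimodule complex. -/
abbrev KBi (i : ℕ) : Type _ := D.KLeft i ⊗[k] D.Alg

/-- Additive statements reduce to tensors with homogeneous left factor and middle factor in one
summand of J_i. The right factor may stay arbitrary because the grading used below ignores it. -/
theorem KBi_induction {i : ℕ} {C : D.KBi i → Prop} (h0 : C 0) (ha : ∀ x y, C x → C y → C (x + y))
    (hm : ∀ (h : ℕ) (u : TensorAlgebra k V) (_ : u ∈ tpow k V h) (c : Idx S i) (x : D.Jsub i c)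
      (β : D.Alg), C ((D.proj u ⊗ₜ DirectSum.lof k _ (fun c => D.Jsub i c) c x) ⊗ₜ β))
    (z : D.KBi i) : C z := by
  induction z using TensorProduct.induction_on with
  | zero => exact h0
  | add x y hx hy => exact ha x y hx hy
  | tmul z β =>
    induction z using TensorProduct.induction_on with
    | zero => rw [TensorProduct.zero_tmul]; exact h0
    | add x y hx hy => rw [TensorProduct.add_tmul]; exact ha _ _ hx hy
    | tmul α y =>
      induction y using DirectSum.induction_on with
      | zero => rw [TensorProduct.tmul_zero, TensorProduct.zero_tmul]; exact h0
      | add x y hx hy => rw [TensorProduct.tmul_add, TensorProduct.add_tmul]; exact ha _ _ hx hy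
      | of c x =>
        obtain ⟨t, rfl⟩ := Ideal.Quotient.mk_surjective α
        have ht : t ∈ ⨆ h, tpow k V h := by
          have := (DirectSum.Decomposition.isInternal
            (LinearMap.range (TensorAlgebra.ι k : V →ₗ[k] TensorAlgebra k V) ^ · :
              ℕ → Submodule k (TensorAlgebra k V))).submodule_iSup_eq_top
          exact this ▸ Submodule.mem_top
        induction ht using Submodule.iSup_induction' with
        | mem h u hu => exact hm h u hu c x β
        | zero => rw [map_zero, TensorProduct.zero_tmul, TensorProduct.zero_tmul]; exact h0
        | add x y _ _ hx hy =>
          rw [map_add, TensorProduct.add_tmul, TensorProduct.add_tmul]; exact ha _ _ hx hy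

/-- The augmentation `A ⊗ V^(0) ⊗ A → A`, `α ⊗ x ⊗ β ↦ α x β`. -/
def augBi : D.KBi 0 →ₗ[D.Alg] D.Alg :=
  bimulExt (DirectSum.toModule k _ _ fun c => D.proj.toLinearMap ∘ₗ (D.Jsub 0 c).subtype)

theorem augBi_tmul (α β : D.Alg) (c : Idx S 0) (x : D.Jsub 0 c) :
    D.augBi ((α ⊗ₜ DirectSum.lof k _ (fun c => D.Jsub 0 c) c x) ⊗ₜ β) =
      α * (D.proj x * β) := by
  rw [augBi, bimulExt_tmul, DirectSum.toModule_lof]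
  rfl

theorem augBi_bimul (α β : D.Alg) (z : D.KBi 0) : D.augBi (bimul k _ α β z) = α * D.augBi z * β := by
  induction z using D.KBi_induction with
  | h0 => simp
  | ha x y hx hy => simp only [map_add, hx, hy, mul_add, add_mul]
  | hm h u _ c x β' => rw [bimul_tmul, augBi_tmul, augBi_tmul]; simp only [mul_assoc]

variable [FiniteDimensional k V]

/-- The differential of the multi-Koszul bimodule complex. On the summand with index `c` it is
`v₁ ⋯ vₙ ↦ ∑_{a + b = p} (-1)^{(i+1) b} v₁ ⋯ vₐ ⊗ vₐ₊₁ ⋯ vₙ₋ᵦ ⊗ vₙ₋ᵦ₊₁ ⋯ vₙ` with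
`p = letters S i c`. -/
def dBi (i : ℕ) : D.KBi (i + 1) →ₗ[D.Alg] D.KBi i :=
  biext (DirectSum.toModule k _ _ fun c =>
    bimap D.Alg (DirectSum.lof k _ (fun c => D.Jsub i c) (target S i c)) ∘ₗ
      cutSum D.proj (letters S i c) ((-1) ^ (i + 1)) (D.Jsub i (target S i c)) ∘ₗ
        (D.Jsub (i + 1) c).subtype)

theorem dBi_tmul (i : ℕ) (α β : D.Alg) (c : Idx S (i + 1)) (x : D.Jsub (i + 1) c) :
    D.dBi i ((α ⊗ₜ DirectSum.lof k _ (fun c => D.Jsub (i + 1) c) c x) ⊗ₜ β) =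
      bimul k _ α β (bimap D.Alg (DirectSum.lof k _ (fun c => D.Jsub i c) (target S i c))
        (cutSum D.proj (letters S i c) ((-1) ^ (i + 1)) (D.Jsub i (target S i c)) x)) := by
  rw [dBi, biext_tmul, DirectSum.toModule_lof]
  rfl

/-- The differential respects the summands of J, so d² can be computed for a single s, with `cutSum`
in place of the direct sum. -/
theorem dBi_bimap (i : ℕ) (c : Idx S (i + 1)) (z : (D.Alg ⊗[k] D.Jsub (i + 1) c) ⊗[k] D.Alg) :
    D.dBi i (bimap D.Alg (DirectSum.lof k _ (fun c => D.Jsub (i + 1) c) c) z) =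
      bimap D.Alg (DirectSum.lof k _ (fun c => D.Jsub i c) (target S i c))
        (biext (cutSum D.proj (letters S i c) ((-1) ^ (i + 1)) (D.Jsub i (target S i c)) ∘ₗ
          (D.Jsub (i + 1) c).subtype) z) := by
  refine (bimap_biext (fun x => ?_) z).symm
  rw [DirectSum.toModule_lof]
  rfl

theorem dBi_dBi (i : ℕ) (z : D.KBi (i + 2)) : D.dBi i (D.dBi (i + 1) z) = 0 := by
  induction z using D.KBi_induction with
  | h0 => simp
  | ha x y hx hy => rw [map_add, map_add, hx, hy, add_zero]
  | hm h u _ c x β =>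
    have hq := letters_add_letters D.two_le i c
    rw [dBi_tmul, dBi, biext_bimul, ← dBi, dBi_bimap, biext_cutSum, map_zero, map_zero]
    -- The parity of i decides which of the two differentials is the one-letter difference: the
    -- second one applied if i is even, the first one if i is odd.
    · rcases Nat.even_or_odd i with h | h
      · exact Or.inr ⟨letters_eq_one _ _ h, by simp [pow_succ, h.neg_one_pow],
          by simp [pow_succ, h.neg_one_pow]⟩
      · exact Or.inl ⟨letters_eq_one _ _ (by simp [h]),
          by simp [pow_succ, h.neg_one_pow], by simp [pow_succ, h.neg_one_pow]⟩
    · intro q hq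
      exact D.Jsub_succ_le _ _ (Finset.HasAntidiagonal.mem_antidiagonal.1 hq) x.2
    · intro q hq
      exact D.Jsub_succ_le _ _ (Finset.HasAntidiagonal.mem_antidiagonal.1 hq)
    · rw [hq]
      exact cutT_eq_zero_of_mem_left _ (D.le_tpow c) (fun _ => D.proj_eq_zero c)
        (D.Jsub_le_R_mul i c x.2)
    · rw [hq]
      exact cutT_eq_zero_of_mem_right _ (D.le_tpow c) (fun _ => D.proj_eq_zero c)
        (D.Jsub_le_mul_R i c x.2)

/-- A letter v goes to v ⊗ 1 ⊗ 1 - 1 ⊗ 1 ⊗ v, whose image in A is v - v. -/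
theorem augBi_dBi (z : D.KBi 1) : D.augBi (D.dBi 0 z) = 0 := by
  induction z using D.KBi_induction with
  | h0 => simp
  | ha x y hx hy => rw [map_add, map_add, hx, hy, add_zero]
  | hm h u _ c x β =>
    rw [dBi_tmul, augBi_bimul]
    have hx : (x : TensorAlgebra k V) ∈ tpow k V 1 := x.2
    have h1 := cut_mul D.proj (W := D.Jsub 0 (target S 0 c)) hx (one_mem_tpow) (one_mem_tpow)
    have h2 := cut_mul D.proj (W := D.Jsub 0 (target S 0 c)) (one_mem_tpow) (one_mem_tpow) hx
    rw [mul_one, mul_one] at h1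
    rw [one_mul, one_mul] at h2
    have h3 : letters S 0 c = 1 := rfl
    rw [h3, cutSum_apply, Finset.Nat.sum_antidiagonal_succ]
    simp [h1, h2, augBi_tmul]

end Complex
end MultiHomogeneous
end MultiKoszul
end

/-! ### The grading of A ⊗ J_i and exactness by leading terms -/

noncomputable section

namespace MultiKoszul
namespace MultiHomogeneous

variable {k V : Type*} [Field k] [AddCommGroup V] [Module k V] {S : Finset ℕ}
  (D : MultiHomogeneous k V S)

section Grading

/-- The homomorphism `T(V) → A[X]` with `v ↦ v X`. -/
def gradeT : TensorAlgebra k V →ₐ[k] Polynomial D.Alg :=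
  TensorAlgebra.lift k ((Polynomial.monomial (R := D.Alg) 1).restrictScalars k ∘ₗ
    D.proj.toLinearMap ∘ₗ TensorAlgebra.ι k)

theorem gradeT_apply {n : ℕ} {u : TensorAlgebra k V} (hu : u ∈ tpow k V n) :
    D.gradeT u = Polynomial.monomial n (D.proj u) := by
  induction n generalizing u with
  | zero =>
    rw [tpow_zero] at hu
    obtain ⟨r, rfl⟩ := Submodule.mem_one.1 hu
    rw [AlgHom.commutes, AlgHom.commutes]
    rfl
  | succ n ih =>
    rw [tpow_add, tpow_one] at hu
    induction hu using Submodule.mul_induction_on' with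
    | mem_mul_mem m hm v hv =>
      obtain ⟨v, rfl⟩ := hv
      rw [map_mul, ih hm, map_mul, ← Polynomial.monomial_mul_monomial, gradeT,
        TensorAlgebra.lift_ι_apply]
      rfl
    | add x _ y _ hx hy => rw [map_add, map_add, map_add, hx, hy]

/-- The homomorphism `A → A[X]` that describes the grading of `A`: an element `a` of degree `n` is
sent to `a Xⁿ`. -/
def gradeA : D.Alg →ₐ[k] Polynomial D.Alg :=
  Ideal.Quotient.liftₐ D.ideal D.gradeT (by
    intro a ha
    have h : TwoSidedIdeal.span (⋃ s, (D.R s : Set (TensorAlgebra k V))) ≤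
        TwoSidedIdeal.ker D.gradeT := by
      rw [TwoSidedIdeal.span_le]
      intro x hx
      obtain ⟨s, hs⟩ := Set.mem_iUnion.1 hx
      refine (TwoSidedIdeal.mem_ker _).2 ?_
      rw [D.gradeT_apply (D.le_tpow s hs), D.proj_eq_zero s hs, Polynomial.monomial_zero_right]
    exact (TwoSidedIdeal.mem_ker _).1 (h ha))

theorem gradeA_proj {n : ℕ} {u : TensorAlgebra k V} (hu : u ∈ tpow k V n) :
    D.gradeA (D.proj u) = Polynomial.monomial n (D.proj u) :=
  D.gradeT_apply hu

/-- The projection of `A` to its component of degree `n - d`. -/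
def component (d n : ℕ) : Module.End k D.Alg :=
  (Polynomial.lcoeff D.Alg n).restrictScalars k ∘ₗ
    LinearMap.mulRight k (Polynomial.X ^ d) ∘ₗ D.gradeA.toLinearMap

/-- The factor X^d shifts the degree up before the coefficient of X^n is read, so n < d gives 0 and
no truncated difference n - d occurs. -/
theorem component_proj (d n : ℕ) {h : ℕ} {u : TensorAlgebra k V} (hu : u ∈ tpow k V h) :
    D.component d n (D.proj u) = if n = h + d then D.proj u else 0 := by
  change (D.gradeA (D.proj u) * Polynomial.X ^ d).coeff n = _
  rw [D.gradeA_proj hu, Polynomial.X_pow_eq_monomial, Polynomial.monomial_mul_monomial,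
    Polynomial.coeff_monomial, mul_one]
  simp only [eq_comm]

/-- The projection of `A ⊗ J_i` to its component of degree `n`. -/
def componentLeft (i n : ℕ) : D.KLeft i →ₗ[k] D.KLeft i :=
  TensorProduct.lift (LinearMap.flip (DirectSum.toModule k _ _ fun c =>
    LinearMap.lcomp k _ (D.component (degree S i c) n) ∘ₗ (TensorProduct.mk k D.Alg (D.J i)).flip ∘ₗ
      DirectSum.lof k _ (fun c => D.Jsub i c) c))

theorem componentLeft_tmul (i n : ℕ) (α : D.Alg) (c : Idx S i) (x : D.Jsub i c) :
    D.componentLeft i n (α ⊗ₜ DirectSum.lof k _ (fun c => D.Jsub i c) c x) =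
      D.component (degree S i c) n α ⊗ₜ DirectSum.lof k _ (fun c => D.Jsub i c) c x := by
  rw [componentLeft, TensorProduct.lift.tmul, LinearMap.flip_apply, DirectSum.toModule_lof]
  rfl

/-- The projection of `A ⊗ J_i ⊗ A` to the component of degree `n` with respect to the grading of
`A ⊗ J_i`. -/
def componentBi (i n : ℕ) : Module.End k (D.KBi i) :=
  LinearMap.rTensor D.Alg (D.componentLeft i n)

theorem componentBi_tmul (i n : ℕ) {h : ℕ} {u : TensorAlgebra k V} (hu : u ∈ tpow k V h)
    (c : Idx S i) (x : D.Jsub i c) (β : D.Alg) :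
    D.componentBi i n ((D.proj u ⊗ₜ DirectSum.lof k _ (fun c => D.Jsub i c) c x) ⊗ₜ β) =
      if n = h + degree S i c then
        (D.proj u ⊗ₜ DirectSum.lof k _ (fun c => D.Jsub i c) c x) ⊗ₜ β else 0 := by
  rw [componentBi, LinearMap.rTensor_tmul, componentLeft_tmul, D.component_proj _ _ hu]
  split_ifs
  · rfl
  · rw [TensorProduct.zero_tmul, TensorProduct.zero_tmul]

theorem componentBi_componentBi (i m n : ℕ) (z : D.KBi i) :
    D.componentBi i n (D.componentBi i m z) = if n = m then D.componentBi i m z else 0 := by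
  induction z using D.KBi_induction with
  | h0 => simp
  | ha x y hx hy =>
    simp only [map_add, hx, hy]
    split_ifs
    · rfl
    · exact add_zero _
  | hm h u hu c x β =>
    rw [D.componentBi_tmul _ _ hu, apply_ite (D.componentBi i n), D.componentBi_tmul _ _ hu,
      map_zero]
    split_ifs <;> first | rfl | omega

theorem exists_sum_componentBi (i : ℕ) (z : D.KBi i) :
    ∃ m, ∑ n ∈ Finset.range m, D.componentBi i n z = z := by
  -- The bound is required for all larger m' as well, so that the maximum serves for a sum of two
  -- elements.
  suffices h : ∃ m, ∀ m', m ≤ m' → ∑ n ∈ Finset.range m', D.componentBi i n z = z from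
    h.imp fun m hm => hm m le_rfl
  induction z using D.KBi_induction with
  | h0 => simp
  | ha x y hx hy =>
    obtain ⟨m, hm⟩ := hx
    obtain ⟨n, hn⟩ := hy
    refine ⟨max m n, fun l hl => ?_⟩
    simp only [map_add, Finset.sum_add_distrib]
    rw [hm l (le_trans (le_max_left _ _) hl), hn l (le_trans (le_max_right _ _) hl)]
  | hm h u hu c x β =>
    refine ⟨h + degree S i c + 1, fun l hl => ?_⟩
    simp only [D.componentBi_tmul _ _ hu]
    rw [Finset.sum_ite_eq', if_pos (Finset.mem_range.2 hl)]

theorem liftLeft_tmul {N : Type*} [AddCommMonoid N] [Module k N] [Module D.Alg N]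
    [IsScalarTower k D.Alg N] {i : ℕ} (f : D.J i →ₗ[k] N) (α : D.Alg) (x : D.J i) :
    D.liftLeft f (α ⊗ₜ x) = α • f x := rfl

variable [FiniteDimensional k V]

/-- The a letters moved to the left still count for the degree, the b letters moved to the right no
longer do. The degree therefore drops by b. -/
theorem componentBi_cut (i n : ℕ) {h : ℕ} {u : TensorAlgebra k V} (hu : u ∈ tpow k V h)
    (c : Idx S i) (β : D.Alg) {a b : ℕ} {x : TensorAlgebra k V}
    (hx : x ∈ tpow k V a * D.Jsub i c * tpow k V b) :
    D.componentBi i n (bimul k _ (D.proj u) β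
      (bimap D.Alg (DirectSum.lof k _ (fun c => D.Jsub i c) c)
        (cut D.proj a b (D.Jsub i c) x))) =
      if n = h + a + degree S i c then bimul k _ (D.proj u) β
        (bimap D.Alg (DirectSum.lof k _ (fun c => D.Jsub i c) c)
          (cut D.proj a b (D.Jsub i c) x)) else 0 := by
  refine mul_mul_induction (C := fun x => D.componentBi i n (bimul k _ (D.proj u) β
      (bimap D.Alg (DirectSum.lof k _ (fun c => D.Jsub i c) c)
        (cut D.proj a b (D.Jsub i c) x))) =
      if n = h + a + degree S i c then bimul k _ (D.proj u) β
        (bimap D.Alg (DirectSum.lof k _ (fun c => D.Jsub i c) c)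
          (cut D.proj a b (D.Jsub i c) x)) else 0)
    (fun v hv w hw v' hv' => ?_) (fun x y hx hy => ?_) hx
  · rw [cut_mul _ hv hw hv', bimap_tmul, bimul_tmul, ← map_mul]
    exact D.componentBi_tmul i n (tpow_add (k := k) (V := V) h a ▸ Submodule.mul_mem_mul hu hv) _ _ _
  · simp only [map_add, hx, hy]
    split_ifs
    · rfl
    · exact add_zero _

/-- For b = 0 the cut is the splitting in the left complex. This identifies the leading term of
`dBi` with `dLeft` tensored with A. -/
theorem splitLeft_tmul_one (n : ℕ) (W : Submodule k (TensorAlgebra k V))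
    (x : (tpow k V n * W : Submodule k (TensorAlgebra k V))) :
    D.splitLeft n W x ⊗ₜ[k] (1 : D.Alg) = cut D.proj n 0 W (x : TensorAlgebra k V) := by
  obtain ⟨z, rfl⟩ := (linearDisjoint_tpow_left n W).mulMap.surjective x
  rw [splitLeft, LinearMap.comp_apply, LinearEquiv.coe_coe, LinearEquiv.symm_apply_apply]
  induction z using TensorProduct.induction_on with
  | zero => simp
  | add x y hx hy =>
    rw [map_add, TensorProduct.add_tmul, hx, hy, map_add, Submodule.coe_add, map_add]
  | tmul u w =>
    have h := cut_mul D.proj u.2 w.2 one_mem_tpow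
    rw [mul_one, map_one] at h
    exact h.symm

theorem rTensor_dLeft_tmul (i : ℕ) (α β : D.Alg) (c : Idx S (i + 1)) (x : D.Jsub (i + 1) c) :
    LinearMap.rTensor D.Alg ((D.dLeft i).restrictScalars k)
      ((α ⊗ₜ DirectSum.lof k _ (fun c => D.Jsub (i + 1) c) c x) ⊗ₜ β) =
      bimul k _ α β (bimap D.Alg (DirectSum.lof k _ (fun c => D.Jsub i c) (target S i c))
        (cut D.proj (letters S i c) 0 (D.Jsub i (target S i c)) x)) := by
  have h1 : D.dLeft i (α ⊗ₜ DirectSum.lof k _ (fun c => D.Jsub (i + 1) c) c x) =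
      α • LinearMap.lTensor D.Alg (DirectSum.lof k _ (fun c => D.Jsub i c) (target S i c))
        (D.splitLeft (letters S i c) (D.Jsub i (target S i c))
          (Submodule.inclusion (D.Jsub_succ_le_left i c) x)) := by
    rw [dLeft, liftLeft_tmul, DirectSum.toModule_lof]
    rfl
  have h2 := D.splitLeft_tmul_one (letters S i c) (D.Jsub i (target S i c))
    (Submodule.inclusion (D.Jsub_succ_le_left i c) x)
  rw [Submodule.coe_inclusion] at h2
  rw [LinearMap.rTensor_tmul, LinearMap.restrictScalars_apply, h1, ← h2]
  generalize D.splitLeft _ _ _ = z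
  induction z using TensorProduct.induction_on with
  | zero => simp
  | add x y hx hy => simp only [map_add, smul_add, TensorProduct.add_tmul, hx, hy]
  | tmul a w => simp [TensorProduct.smul_tmul']

theorem rTensor_dLeft_componentBi (i n : ℕ) (z : D.KBi (i + 1)) :
    LinearMap.rTensor D.Alg ((D.dLeft i).restrictScalars k) (D.componentBi (i + 1) n z) =
      D.componentBi i n (LinearMap.rTensor D.Alg ((D.dLeft i).restrictScalars k) z) := by
  induction z using D.KBi_induction with
  | h0 => simp
  | ha x y hx hy => simp only [map_add, hx, hy]
  | hm h u hu c x β =>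
    rw [D.componentBi_tmul _ _ hu, apply_ite (LinearMap.rTensor D.Alg _), rTensor_dLeft_tmul,
      D.componentBi_cut _ _ hu _ _ (D.Jsub_succ_le i c (add_zero _) x.2),
      degree_succ D.two_le, map_zero, add_assoc]

theorem componentBi_dBi_sub (i m n : ℕ) (z : D.KBi (i + 1)) (hmn : m ≤ n) :
    D.componentBi i n (D.dBi i (D.componentBi (i + 1) m z) -
      LinearMap.rTensor D.Alg ((D.dLeft i).restrictScalars k) (D.componentBi (i + 1) m z)) = 0 := by
  rw [map_sub, sub_eq_zero]
  induction z using D.KBi_induction with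
  | h0 => simp
  | ha x y hx hy => simp only [map_add, hx, hy]
  | hm h u hu c x β =>
    rw [D.componentBi_tmul _ _ hu]
    split_ifs with hm
    -- Only the term with b = 0, which is the leading one, can contribute in degree n ≥ m; a term
    -- with b > 0 lies in degree m - b.
    · rw [rTensor_dLeft_tmul, dBi_tmul, cutSum_apply, map_sum, map_sum, map_sum,
        Finset.sum_eq_single (letters S i c, 0)]
      · simp
      · rintro ⟨a, b⟩ hq hne
        have hab : a + b = letters S i c := Finset.HasAntidiagonal.mem_antidiagonal.1 hq
        have hb : b ≠ 0 := by
          rintro rfl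
          exact hne (by rw [← hab, add_zero])
        rw [map_smul, map_smul, map_smul,
          D.componentBi_cut _ _ hu _ _ (D.Jsub_succ_le i c hab x.2), if_neg, smul_zero]
        have := degree_succ D.two_le i c
        omega
      · intro hq
        exact absurd (Finset.HasAntidiagonal.mem_antidiagonal.2 (add_zero _)) hq
    · simp

/-- The leading part is exact because A is flat over the field k; exactness passes from it to the
whole differential. -/
theorem exact_dBi_succ (h : D.IsLeftMultiKoszul) (i : ℕ) :
    Function.Exact (D.dBi (i + 1)) (D.dBi i) := by
  have hex : Function.Exact
      (LinearMap.rTensor D.Alg ((D.dLeft (i + 1)).restrictScalars k))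
      (LinearMap.rTensor D.Alg ((D.dLeft i).restrictScalars k)) :=
    Module.Flat.rTensor_exact D.Alg (h.exact_succ i)
  let d1 : D.KBi (i + 2) →+ D.KBi (i + 1) := (D.dBi (i + 1)).toAddMonoidHom
  let d2 : D.KBi (i + 1) →+ D.KBi i := (D.dBi i).toAddMonoidHom
  let e1 : D.KBi (i + 2) →+ D.KBi (i + 1) :=
    (LinearMap.rTensor D.Alg ((D.dLeft (i + 1)).restrictScalars k)).toAddMonoidHom
  let e2 : D.KBi (i + 1) →+ D.KBi i :=
    (LinearMap.rTensor D.Alg ((D.dLeft i).restrictScalars k)).toAddMonoidHom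
  let P (j n : ℕ) : D.KBi j →+ D.KBi j := (D.componentBi j n).toAddMonoidHom
  refine exact_of_exact_leading (L := D.KBi (i + 2)) (M := D.KBi (i + 1)) (N := D.KBi i)
    (d := d1) (d' := d2) (d0 := e1) (d0' := e2) (PL := P (i + 2)) (PM := P (i + 1)) (PN := P i)
    ?_ ?_ ?_ ?_ ?_ ?_ ?_ ?_
  · exact D.componentBi_componentBi (i + 1)
  · exact D.exists_sum_componentBi (i + 1)
  · exact D.dBi_dBi i
  · exact fun x => (hex x).1
  · exact D.rTensor_dLeft_componentBi (i + 1)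
  · exact D.rTensor_dLeft_componentBi i
  · exact D.componentBi_dBi_sub (i + 1)
  · exact D.componentBi_dBi_sub i

end Grading
end MultiHomogeneous
end MultiKoszul
end

/-! ### Exactness at the augmentation and left-linear splitting -/

noncomputable section

namespace MultiKoszul
namespace MultiHomogeneous

variable {k V : Type*} [Field k] [AddCommGroup V] [Module k V] {S : Finset ℕ}
  (D : MultiHomogeneous k V S)

section Augmentation

theorem aug_proj_eq_zero {n : ℕ} (hn : n ≠ 0) {u : TensorAlgebra k V} (hu : u ∈ tpow k V n) :
    D.aug (D.proj u) = 0 := by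
  obtain ⟨m, rfl⟩ := Nat.exists_eq_succ_of_ne_zero hn
  exact algebraMapInv_eq_zero hu

theorem proj_eq_algebraMap {u : TensorAlgebra k V} (hu : u ∈ tpow k V 0) :
    D.proj u = algebraMap k D.Alg (D.aug (D.proj u)) := by
  rw [tpow_zero] at hu
  obtain ⟨r, rfl⟩ := Submodule.mem_one.1 hu
  rw [AlgHom.commutes, AlgHom.commutes]
  rfl

theorem augLeft_tmul (α : D.Alg) (c : Idx S 0) (x : D.Jsub 0 c) :
    D.augLeft (α ⊗ₜ DirectSum.lof k _ (fun c => D.Jsub 0 c) c x) =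
      D.toTriv (D.aug α * D.aug (D.proj x)) := by
  rw [augLeft, liftLeft_tmul, DirectSum.toModule_lof]
  rfl

/-- The map `A ⊗ V^(0) ⊗ A → A`, `α ⊗ x ⊗ β ↦ ε(α x) β`, induced by the augmentation of the left
multi-Koszul complex. -/
def augLeftBi : D.KBi 0 →ₗ[k] D.Alg :=
  (TensorProduct.lid k D.Alg).toLinearMap ∘ₗ
    LinearMap.rTensor D.Alg D.toTriv.symm.toLinearMap ∘ₗ
      LinearMap.rTensor D.Alg (D.augLeft.restrictScalars k)

theorem augLeftBi_tmul (α β : D.Alg) (c : Idx S 0) (x : D.Jsub 0 c) :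
    D.augLeftBi ((α ⊗ₜ DirectSum.lof k _ (fun c => D.Jsub 0 c) c x) ⊗ₜ β) =
      (D.aug α * D.aug (D.proj x)) • β := by
  simp only [augLeftBi, LinearMap.comp_apply, LinearMap.rTensor_tmul,
    LinearMap.restrictScalars_apply, augLeft_tmul, LinearEquiv.coe_coe,
    LinearEquiv.symm_apply_apply, TensorProduct.lid_tmul]

/-- The projection of `A`, placed in degree `0`, to its component of degree `n`. -/
def componentAug (n : ℕ) : D.Alg →ₗ[k] D.Alg := if n = 0 then LinearMap.id else 0

/-- The target sits in degree 0, and ε kills left factors of positive degree. -/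
theorem augLeftBi_componentBi (n : ℕ) (z : D.KBi 0) :
    D.augLeftBi (D.componentBi 0 n z) = D.componentAug n (D.augLeftBi z) := by
  induction z using D.KBi_induction with
  | h0 => simp
  | ha x y hx hy => simp only [map_add, hx, hy]
  | hm h u hu c x β =>
    rw [D.componentBi_tmul _ _ hu, componentAug, show degree S 0 c = 0 from rfl, add_zero]
    by_cases hh : h = 0
    · subst hh
      split_ifs <;> simp
    · have h0 : D.augLeftBi ((D.proj u ⊗ₜ DirectSum.lof k _ (fun c => D.Jsub 0 c) c x) ⊗ₜ β) = 0 := by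
        rw [augLeftBi_tmul, D.aug_proj_eq_zero hh hu, zero_mul, zero_smul]
      rw [apply_ite D.augLeftBi, h0, map_zero, map_zero, ite_self]

/-- Only n = m = 0 matters. There the left factor is a scalar, on which ε is the identity, so both
augmentations agree. -/
theorem componentAug_augBi_sub (m n : ℕ) (z : D.KBi 0) (hmn : m ≤ n) :
    D.componentAug n (D.augBi (D.componentBi 0 m z) - D.augLeftBi (D.componentBi 0 m z)) = 0 := by
  rw [map_sub, sub_eq_zero]
  induction z using D.KBi_induction with
  | h0 => simp
  | ha x y hx hy => simp only [map_add, hx, hy]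
  | hm h u hu c x β =>
    rw [D.componentBi_tmul _ _ hu, componentAug, show degree S 0 c = 0 from rfl, add_zero]
    split_ifs with h1 h2 h2
    · have hh : h = 0 := by omega
      subst hh
      have hx : (x : TensorAlgebra k V) ∈ tpow k V 0 := x.2
      rw [augLeftBi_tmul, augBi_tmul, D.proj_eq_algebraMap hu, D.proj_eq_algebraMap hx,
        LinearMap.id_apply, LinearMap.id_apply, AlgHom.commutes, AlgHom.commutes,
        ← Algebra.smul_def, ← Algebra.smul_def, smul_smul]
      rfl
    all_goals simp

/-- The index of the only summand of `J_0`. -/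
def zeroIdx (S : Finset ℕ) : Idx S 0 := ()

/-- The section of the augmentation of the bimodule complex. -/
def augBiSection : D.Alg →ₗ[D.Alg] D.KBi 0 :=
  LinearMap.toSpanSingleton D.Alg _
    ((1 ⊗ₜ DirectSum.lof k _ (fun c => D.Jsub 0 c) (zeroIdx S) ⟨1, one_mem_tpow⟩) ⊗ₜ 1)

theorem augBi_augBiSection (α : D.Alg) : D.augBi (D.augBiSection α) = α := by
  rw [augBiSection, LinearMap.toSpanSingleton_apply, map_smul, augBi_tmul]
  simp

variable [FiniteDimensional k V]

/-- The leading-term argument again, now with the last term A in degree 0. -/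
theorem exact_dBi_zero (h : D.IsLeftMultiKoszul) : Function.Exact (D.dBi 0) D.augBi := by
  have hex : Function.Exact
      (LinearMap.rTensor D.Alg ((D.dLeft 0).restrictScalars k))
      (LinearMap.rTensor D.Alg (D.augLeft.restrictScalars k)) :=
    Module.Flat.rTensor_exact D.Alg h.exact_zero
  let d1 : D.KBi 1 →+ D.KBi 0 := (D.dBi 0).toAddMonoidHom
  let d2 : D.KBi 0 →+ D.Alg := D.augBi.toAddMonoidHom
  let e1 : D.KBi 1 →+ D.KBi 0 :=
    (LinearMap.rTensor D.Alg ((D.dLeft 0).restrictScalars k)).toAddMonoidHom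
  let e2 : D.KBi 0 →+ D.Alg := D.augLeftBi.toAddMonoidHom
  let P (j n : ℕ) : D.KBi j →+ D.KBi j := (D.componentBi j n).toAddMonoidHom
  let Q (n : ℕ) : D.Alg →+ D.Alg := (D.componentAug n).toAddMonoidHom
  refine exact_of_exact_leading (L := D.KBi 1) (M := D.KBi 0) (N := D.Alg)
    (d := d1) (d' := d2) (d0 := e1) (d0' := e2) (PL := P 1) (PM := P 0) (PN := Q)
    ?_ ?_ ?_ ?_ ?_ ?_ ?_ ?_
  · exact D.componentBi_componentBi 0
  · exact D.exists_sum_componentBi 0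
  · exact D.augBi_dBi
  · intro x hx
    refine (hex x).1 ?_
    -- The tensored augmentation and `augLeftBi` differ by the identification of k ⊗ A with A, so
    -- they have the same kernel.
    have hinj : Function.Injective (LinearMap.rTensor D.Alg D.toTriv.symm.toLinearMap) :=
      (LinearEquiv.rTensor D.Alg D.toTriv.symm).injective
    apply hinj
    apply (TensorProduct.lid k D.Alg).injective
    rw [map_zero, map_zero]
    exact hx
  · exact D.rTensor_dLeft_componentBi 0
  · exact D.augLeftBi_componentBi
  · exact D.componentBi_dBi_sub 0
  · exact D.componentAug_augBi_sub

/-- The splitting starts at the augmentation, with α ↦ α ⊗ 1 ⊗ 1, and propagates by projectivity of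
the terms as left modules. The sections are only left linear, which suffices for k ⊗_A -. -/
theorem exists_section_dBi (h : D.IsLeftMultiKoszul) (i : ℕ) :
    ∃ s : D.KBi i →ₗ[D.Alg] D.KBi (i + 1), ∀ y, D.dBi i (s (D.dBi i y)) = D.dBi i y := by
  induction i with
  | zero =>
    exact exists_section_of_exact (B := D.Alg) (L := D.KBi 1) (M := D.KBi 0) (N := D.Alg)
      (g := D.augBi) (D.exact_dBi_zero h) (t := D.augBiSection)
      fun x => D.augBi_augBiSection _
  | succ i ih =>
    obtain ⟨t, ht⟩ := ih
    exact exists_section_of_exact (B := D.Alg) (L := D.KBi (i + 2)) (M := D.KBi (i + 1))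
      (N := D.KBi i) (f := D.dBi (i + 1)) (g := D.dBi i) (D.exact_dBi_succ h i) ht

end Augmentation
end MultiHomogeneous
end MultiKoszul
end

/-! ### Reduction k ⊗_A - to the right complex -/

noncomputable section

namespace MultiKoszul
namespace MultiHomogeneous

variable {k V : Type*} [Field k] [AddCommGroup V] [Module k V] {S : Finset ℕ}
  (D : MultiHomogeneous k V S)

section Reduction

/-- The map `A ⊗ J_i ⊗ A → J_i ⊗ A` induced by the augmentation of the left factor. -/
def redRight (i : ℕ) : D.KBi i →ₗ[k] D.KRight i :=
  LinearMap.rTensor D.Alg ((TensorProduct.lid k (D.J i)).toLinearMap ∘ₗ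
    LinearMap.rTensor (D.J i) D.aug.toLinearMap)

theorem redRight_tmul (i : ℕ) (α β : D.Alg) (x : D.J i) :
    D.redRight i ((α ⊗ₜ x) ⊗ₜ β) = D.aug α • (x ⊗ₜ β) := rfl

/-- The map `J_i ⊗ A → A ⊗ J_i ⊗ A`, `z ↦ 1 ⊗ z`. -/
def inclRight (i : ℕ) : D.KRight i →ₗ[k] D.KBi i :=
  LinearMap.rTensor D.Alg (TensorProduct.mk k D.Alg (D.J i) 1)

theorem redRight_inclRight (i : ℕ) (z : D.KRight i) : D.redRight i (D.inclRight i z) = z := by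
  induction z using TensorProduct.induction_on with
  | zero => simp
  | add x y hx hy => rw [map_add, map_add, hx, hy]
  | tmul x β =>
    rw [inclRight, LinearMap.rTensor_tmul, TensorProduct.mk_apply, redRight_tmul, map_one, one_smul]

theorem redRight_smul (i : ℕ) (a : D.Alg) (z : D.KBi i) :
    D.redRight i (a • z) = D.aug a • D.redRight i z := by
  induction z using D.KBi_induction with
  | h0 => simp
  | ha x y hx hy => simp only [smul_add, map_add, hx, hy]
  | hm h u _ c x β =>
    rw [TensorProduct.smul_tmul', TensorProduct.smul_tmul', redRight_tmul, redRight_tmul,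
      smul_eq_mul, map_mul, mul_smul]

/-- A left-linear map descends to the quotients k ⊗_A -: z may be replaced by 1 ⊗ (its reduction),
since a left factor α can be pulled through t and then acts by ε(α). Thus the sections descend too.
-/
theorem redRight_comp (i j : ℕ) (t : D.KBi i →ₗ[D.Alg] D.KBi j) (z : D.KBi i) :
    D.redRight j (t z) = D.redRight j (t (D.inclRight i (D.redRight i z))) := by
  induction z using D.KBi_induction with
  | h0 => simp
  | ha x y hx hy => simp only [map_add, hx, hy]
  | hm h u _ c x β =>
    generalize D.proj u = α
    have h1 : ∀ γ : D.Alg, (γ ⊗ₜ DirectSum.lof k _ (fun c => D.Jsub i c) c x) ⊗ₜ[k] β =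
        γ • ((1 ⊗ₜ DirectSum.lof k _ (fun c => D.Jsub i c) c x) ⊗ₜ[k] β : D.KBi i) := by
      intro γ
      rw [TensorProduct.smul_tmul', TensorProduct.smul_tmul', smul_eq_mul, mul_one]
    have h2 : D.inclRight i (D.redRight i
        ((α ⊗ₜ DirectSum.lof k _ (fun c => D.Jsub i c) c x) ⊗ₜ[k] β)) =
        algebraMap k D.Alg (D.aug α) •
          ((1 ⊗ₜ DirectSum.lof k _ (fun c => D.Jsub i c) c x) ⊗ₜ[k] β : D.KBi i) := by
      rw [redRight_tmul, map_smul, inclRight, LinearMap.rTensor_tmul, TensorProduct.mk_apply,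
        algebraMap_smul]
    rw [h2, h1, t.map_smul, t.map_smul, redRight_smul, redRight_smul, AlgHom.commutes]
    rfl

theorem liftRight_tmul {N : Type*} [AddCommMonoid N] [Module k N] [Module D.Algᵐᵒᵖ N]
    [IsScalarTower k D.Algᵐᵒᵖ N] {i : ℕ} (f : D.J i →ₗ[k] N) (β : D.Alg) (x : D.J i) :
    D.liftRight f (x ⊗ₜ β) = MulOpposite.op β • f x := rfl

theorem augRight_tmul (β : D.Alg) (c : Idx S 0) (x : D.Jsub 0 c) :
    D.augRight (DirectSum.lof k _ (fun c => D.Jsub 0 c) c x ⊗ₜ β) =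
      D.toTriv (D.aug β * D.aug (D.proj x)) := by
  rw [augRight, liftRight_tmul, DirectSum.toModule_lof]
  rfl

theorem augRight_surjective : Function.Surjective D.augRight := by
  intro c
  refine ⟨DirectSum.lof k _ (fun c => D.Jsub 0 c) (zeroIdx S) ⟨1, one_mem_tpow⟩ ⊗ₜ
    algebraMap k D.Alg (D.toTriv.symm c), ?_⟩
  rw [augRight_tmul, map_one, map_one, mul_one, AlgHom.commutes]
  exact D.toTriv.apply_symm_apply c

theorem augRight_redRight (z : D.KBi 0) :
    D.augRight (D.redRight 0 z) = D.toTriv (D.aug (D.augBi z)) := by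
  induction z using D.KBi_induction with
  | h0 => simp
  | ha x y hx hy => simp only [map_add, hx, hy]
  | hm h u _ c x β =>
    rw [redRight_tmul, augBi_tmul, LinearMap.map_smul_of_tower, augRight_tmul, ← map_smul,
      map_mul D.aug, map_mul D.aug, smul_eq_mul, mul_comm (D.aug β)]

/-- Up to exchanging the factors this is the extension of scalars of a vector space to the opposite
ring, hence free. -/
theorem projective_KRight (i : ℕ) : Module.Projective D.Algᵐᵒᵖ (D.KRight i) := by
  let e : D.Algᵐᵒᵖ ⊗[k] D.J i ≃ₗ[k] D.KRight i :=
    TensorProduct.comm k _ _ ≪≫ₗ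
      LinearEquiv.lTensor (D.J i) (MulOpposite.opLinearEquiv k (M := D.Alg)).symm
  have he : ∀ (a : D.Algᵐᵒᵖ) (z : D.Algᵐᵒᵖ ⊗[k] D.J i), e (a • z) = a • e z := by
    intro a z
    induction z using TensorProduct.induction_on with
    | zero => simp
    | add x y hx hy => rw [smul_add, map_add, hx, hy, map_add, smul_add]
    | tmul b x => rfl
  let e' : D.Algᵐᵒᵖ ⊗[k] D.J i ≃ₗ[D.Algᵐᵒᵖ] D.KRight i := { e with map_smul' := he }
  exact Module.Projective.of_equiv e'

/-- The map `redRight` with the signs that make it a homomorphism of complexes in two consecutive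
degrees. -/
def signedRedRight (i j : ℕ) : D.KBi i →+ D.KRight i :=
  ((-1 : k) ^ j • D.redRight i).toAddMonoidHom

theorem signedRedRight_apply (i j : ℕ) (z : D.KBi i) :
    D.signedRedRight i j z = (-1 : k) ^ j • D.redRight i z := rfl

theorem signedRedRight_surjective (i j : ℕ) : Function.Surjective (D.signedRedRight i j) := by
  intro z
  refine ⟨D.inclRight i ((-1 : k) ^ j • z), ?_⟩
  rw [signedRedRight_apply, redRight_inclRight, smul_smul, ← mul_pow, neg_one_mul, neg_neg, one_pow,
    one_smul]

variable [FiniteDimensional k V]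

theorem cut_zero_left (n : ℕ) (W : Submodule k (TensorAlgebra k V))
    (x : (W * tpow k V n : Submodule k (TensorAlgebra k V))) :
    cut D.proj 0 n W (x : TensorAlgebra k V) =
      LinearMap.rTensor D.Alg (TensorProduct.mk k D.Alg W 1) (D.splitRight n W x) := by
  obtain ⟨z, rfl⟩ := (linearDisjoint_tpow_right n W).mulMap.surjective x
  rw [splitRight, LinearMap.comp_apply, LinearEquiv.coe_coe, LinearEquiv.symm_apply_apply]
  induction z using TensorProduct.induction_on with
  | zero => simp
  | add x y hx hy => simp only [map_add, Submodule.coe_add, hx, hy]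
  | tmul w u =>
    have h := cut_mul D.proj one_mem_tpow w.2 u.2
    rw [one_mul, map_one] at h
    exact h

theorem redRight_cut_zero (i : ℕ) (α β : D.Alg) (c : Idx S i) (n : ℕ)
    (x : (D.Jsub i c * tpow k V n : Submodule k (TensorAlgebra k V))) :
    D.redRight i (bimul k _ α β (bimap D.Alg (DirectSum.lof k _ (fun c => D.Jsub i c) c)
      (cut D.proj 0 n (D.Jsub i c) x))) =
      D.aug α • (MulOpposite.op β • (LinearMap.rTensor D.Alg
        (DirectSum.lof k _ (fun c => D.Jsub i c) c) (D.splitRight n (D.Jsub i c) x) :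
          D.KRight i)) := by
  rw [cut_zero_left]
  generalize D.splitRight _ _ _ = z
  induction z using TensorProduct.induction_on with
  | zero => simp
  | add x y hx hy => simp only [map_add, smul_add, hx, hy]
  | tmul w γ =>
    rw [LinearMap.rTensor_tmul, LinearMap.rTensor_tmul, TensorProduct.mk_apply, bimap_tmul,
      bimul_tmul, redRight_tmul, mul_one, op_smul_tmul]

/-- The a > 0 letters moved to the left are killed by ε. -/
theorem redRight_cut_ne_zero (i : ℕ) (α β : D.Alg) (c : Idx S i) {a b : ℕ} (ha : a ≠ 0)
    {x : TensorAlgebra k V} (hx : x ∈ tpow k V a * D.Jsub i c * tpow k V b) :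
    D.redRight i (bimul k _ α β (bimap D.Alg (DirectSum.lof k _ (fun c => D.Jsub i c) c)
      (cut D.proj a b (D.Jsub i c) x))) = 0 := by
  refine mul_mul_induction (C := fun x => D.redRight i (bimul k _ α β
    (bimap D.Alg (DirectSum.lof k _ (fun c => D.Jsub i c) c) (cut D.proj a b (D.Jsub i c) x))) = 0)
    (fun v hv w hw v' hv' => ?_) (fun x y hx hy => ?_) hx
  · rw [cut_mul _ hv hw hv', bimap_tmul, bimul_tmul, redRight_tmul, map_mul,
      D.aug_proj_eq_zero ha hv, mul_zero, zero_smul]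
  · simp only [map_add, hx, hy, add_zero]

/-- Only the cut with a = 0 survives the augmentation of the left factor. What remains is the right
differential with the coefficient of that cut. -/
theorem redRight_dBi (i : ℕ) (z : D.KBi (i + 1)) :
    D.redRight i (D.dBi i z) = D.dRight i ((-1 : k) ^ (i + 1) • D.redRight (i + 1) z) := by
  induction z using D.KBi_induction with
  | h0 => simp
  | ha x y hx hy => simp only [map_add, smul_add, hx, hy]
  | hm h u _ c x β =>
    -- The coefficient is σ^p with σ = (-1)^(i+1). It equals σ in both parities: either p = 1 or σ =
    -- 1.
    have h1 : ((-1 : k) ^ (i + 1)) ^ letters S i c = (-1) ^ (i + 1) := by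
      rcases Nat.even_or_odd i with h | h
      · rw [letters_eq_one i c h, pow_one]
      · rw [h.add_one.neg_one_pow, one_pow]
    have h2 : D.dRight i (DirectSum.lof k _ (fun c => D.Jsub (i + 1) c) c x ⊗ₜ β) =
        MulOpposite.op β • (LinearMap.rTensor D.Alg
          (DirectSum.lof k _ (fun c => D.Jsub i c) (target S i c))
          (D.splitRight (letters S i c) (D.Jsub i (target S i c))
            (Submodule.inclusion (D.Jsub_succ_le_right i c) x)) : D.KRight i) := by
      rw [dRight, liftRight_tmul, DirectSum.toModule_lof]
      rfl
    rw [dBi_tmul, cutSum_apply, map_sum, map_sum, map_sum, Finset.sum_eq_single (0, letters S i c)]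
    · have h3 := D.redRight_cut_zero i (D.proj u) β (target S i c) (letters S i c)
        (Submodule.inclusion (D.Jsub_succ_le_right i c) x)
      rw [Submodule.coe_inclusion] at h3
      rw [map_smul, map_smul, map_smul, h3, redRight_tmul, LinearMap.map_smul_of_tower,
        LinearMap.map_smul_of_tower, h2, h1]
    · rintro ⟨a, b⟩ hq hne
      have hab : a + b = letters S i c := Finset.HasAntidiagonal.mem_antidiagonal.1 hq
      have ha : a ≠ 0 := by
        rintro rfl
        exact hne (by rw [← hab, zero_add])
      rw [map_smul, map_smul, map_smul,
        D.redRight_cut_ne_zero i _ _ _ ha (D.Jsub_succ_le i c hab x.2), smul_zero]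
    · intro hq
      exact absurd (Finset.HasAntidiagonal.mem_antidiagonal.2 (zero_add _)) hq

/-- Both exactness claims are instances of `exact_of_section`: the right complex is the reduction of
the split exact bimodule complex. -/
theorem isRightMultiKoszul_of_isLeftMultiKoszul (h : D.IsLeftMultiKoszul) :
    D.IsRightMultiKoszul where
  projective := D.projective_KRight
  surjective := D.augRight_surjective
  exact_zero := by
    have hex := D.exact_dBi_zero h
    let f : D.KBi 1 →+ D.KBi 0 := (D.dBi 0).toAddMonoidHom
    let g : D.KBi 0 →+ D.Alg := D.augBi.toAddMonoidHom
    let t : D.Alg →+ D.KBi 0 := D.augBiSection.toAddMonoidHom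
    let f' : D.KRight 1 →+ D.KRight 0 := (D.dRight 0).toAddMonoidHom
    let g' : D.KRight 0 →+ D.Triv := D.augRight.toAddMonoidHom
    let q : D.Alg →+ D.Triv := (D.toTriv.toLinearMap ∘ₗ D.aug.toLinearMap).toAddMonoidHom
    let r : D.Triv →+ D.KRight 0 := (LinearMap.toSpanSingleton k (D.KRight 0)
      (D.redRight 0 (D.augBiSection 1)) ∘ₗ D.toTriv.symm.toLinearMap).toAddMonoidHom
    refine exact_of_section (L := D.KBi 1) (M := D.KBi 0) (N := D.Alg) (L' := D.KRight 1)
      (M' := D.KRight 0) (N' := D.Triv) (f := f) (g := g) hex (t := t) (f' := f') (g' := g')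
      (qL := D.signedRedRight 1 1) (qM := (D.redRight 0).toAddMonoidHom) (qN := q) (h := r)
      ?_ ?_ ?_ ?_ ?_ ?_
    · exact fun x => D.augBi_augBiSection _
    · exact D.signedRedRight_surjective 1 1
    · exact fun z => ⟨_, D.redRight_inclRight 0 z⟩
    · exact D.redRight_dBi 0
    · exact fun x => (D.augRight_redRight x).symm
    · intro a
      change D.redRight 0 (D.augBiSection a) = D.aug a • D.redRight 0 (D.augBiSection 1)
      rw [← redRight_smul, ← map_smul, smul_eq_mul, mul_one]
  exact_succ i := by
    have hex := D.exact_dBi_succ h i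
    obtain ⟨s, hs⟩ := D.exists_section_dBi h i
    let f : D.KBi (i + 2) →+ D.KBi (i + 1) := (D.dBi (i + 1)).toAddMonoidHom
    let g : D.KBi (i + 1) →+ D.KBi i := (D.dBi i).toAddMonoidHom
    let t : D.KBi i →+ D.KBi (i + 1) := s.toAddMonoidHom
    let f' : D.KRight (i + 2) →+ D.KRight (i + 1) := (D.dRight (i + 1)).toAddMonoidHom
    let g' : D.KRight (i + 1) →+ D.KRight i := (D.dRight i).toAddMonoidHom
    -- The section s descends along 1 ⊗ -, with the sign carried by the reduction of its target. The
    -- signs (-1)^1, (-1)^(i+1), 1 on the three terms make both squares commute, as (i+1) + (i+2) is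
    -- odd.
    let r : D.KRight i →+ D.KRight (i + 1) := (((-1 : k) ^ (i + 1) • D.redRight (i + 1)) ∘ₗ
      s.restrictScalars k ∘ₗ D.inclRight i).toAddMonoidHom
    refine exact_of_section (L := D.KBi (i + 2)) (M := D.KBi (i + 1)) (N := D.KBi i)
      (L' := D.KRight (i + 2)) (M' := D.KRight (i + 1)) (N' := D.KRight i) (f := f) (g := g) hex
      (t := t) (f' := f') (g' := g') (qL := D.signedRedRight (i + 2) 1)
      (qM := D.signedRedRight (i + 1) (i + 1)) (qN := (D.redRight i).toAddMonoidHom) (h := r)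
      ?_ ?_ ?_ ?_ ?_ ?_
    · exact hs
    · exact D.signedRedRight_surjective _ _
    · exact D.signedRedRight_surjective _ _
    · intro x
      change (-1 : k) ^ (i + 1) • D.redRight (i + 1) (D.dBi (i + 1) x) =
        D.dRight (i + 1) ((-1 : k) ^ 1 • D.redRight (i + 2) x)
      rw [redRight_dBi, ← LinearMap.map_smul_of_tower, smul_smul, ← pow_add,
        show i + 1 + (i + 1 + 1) = 2 * (i + 1) + 1 by ring, pow_add, pow_mul]
      simp
    · exact D.redRight_dBi i
    · intro z
      change (-1 : k) ^ (i + 1) • D.redRight (i + 1) (s z) =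
        (-1 : k) ^ (i + 1) • D.redRight (i + 1) (s (D.inclRight i (D.redRight i z)))
      rw [← redRight_comp]

end Reduction
end MultiHomogeneous
end MultiKoszul
end

/-! ### Reversal of words and the opposite algebra -/

noncomputable section

namespace MultiKoszul

theorem map_rev_iInf {k V : Type*} [Field k] [AddCommGroup V] [Module k V] {α : Type*}
    [Nonempty α] (W : α → Submodule k (TensorAlgebra k V)) :
    (⨅ a, W a).map (rev k V) = ⨅ a, (W a).map (rev k V) :=
  Submodule.map_iInf _ rev_injective

/-- Reversal turns the condition at position j into the one at position n_s(i) - s - j, so it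
permutes the intersected subspaces. -/
theorem map_rev_Jpow {k V : Type*} [Field k] [AddCommGroup V] [Module k V]
    (M : Submodule k (TensorAlgebra k V)) (s i : ℕ) :
    (Jpow M s i).map (rev k V) = Jpow (M.map (rev k V)) s i := by
  unfold Jpow
  rw [map_rev_iInf]
  refine Fin.revPerm.iInf_congr fun j => ?_
  have hj := j.2
  rw [map_rev_mul, map_rev_mul, map_rev_tpow, map_rev_tpow, ← mul_assoc, Fin.revPerm_apply,
    Fin.val_rev, show nfun s i - s + 1 - (j + 1) = nfun s i - s - j by omega,
    show nfun s i - s - (nfun s i - s - j) = j by omega]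

/-- Exactness is invariant under isomorphism. -/
theorem exact_of_bijective {L M N L' M' N' : Type*} [Zero N] [Zero N'] {f : L → M} {g : M → N}
    {f' : L' → M'} {g' : M' → N'} {a : L → L'} {b : M → M'} {c : N → N'}
    (ha : Function.Surjective a) (hb : Function.Bijective b) (hc : Function.Injective c)
    (h0 : c 0 = 0) (hf : ∀ x, f' (a x) = b (f x)) (hg : ∀ x, g' (b x) = c (g x)) :
    Function.Exact f g ↔ Function.Exact f' g' := by
  constructor
  · intro h y
    obtain ⟨x, rfl⟩ := hb.2 y
    rw [hg, ← h0, hc.eq_iff, h]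
    constructor
    · rintro ⟨z, rfl⟩
      exact ⟨a z, hf z⟩
    · rintro ⟨z, hz⟩
      obtain ⟨z, rfl⟩ := ha z
      exact ⟨z, hb.1 (by rw [← hf, hz])⟩
  · intro h x
    rw [← hc.eq_iff, h0, ← hg, h]
    constructor
    · rintro ⟨z, hz⟩
      obtain ⟨z, rfl⟩ := ha z
      exact ⟨z, hb.1 (by rw [← hf, hz])⟩
    · rintro ⟨z, rfl⟩
      exact ⟨a z, hf z⟩

namespace MultiHomogeneous

variable {k V : Type*} [Field k] [AddCommGroup V] [Module k V] {S : Finset ℕ}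

section Opposite

/-- `E` is opposite to `D`: its relations are the reversed relations of `D`. -/
def IsOpposite (D E : MultiHomogeneous k V S) : Prop := ∀ s, E.R s = (D.R s).map (rev k V)

theorem isOpposite_opposite (D : MultiHomogeneous k V S) : D.IsOpposite D.opposite := fun _ => rfl

variable {D E : MultiHomogeneous k V S}

theorem IsOpposite.symm (h : D.IsOpposite E) : E.IsOpposite D := fun s => by
  rw [h s, map_rev_map_rev]

theorem IsOpposite.map_rev_Jsub (h : D.IsOpposite E) : ∀ (i : ℕ) (c : Idx S i),
    (D.Jsub i c).map (rev k V) = E.Jsub i c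
  | 0, _ => map_rev_tpow 0
  | 1, _ => map_rev_tpow 1
  | i + 2, s => by
    change (Jpow (D.R s) _ _).map (rev k V) = Jpow (E.R s) _ _
    rw [map_rev_Jpow, h s]

/-- The anti-isomorphism `A → A°` as a homomorphism to the opposite algebra. -/
def IsOpposite.algOp (h : D.IsOpposite E) : D.Alg →ₐ[k] E.Algᵐᵒᵖ :=
  Ideal.Quotient.liftₐ D.ideal ((AlgHom.op E.proj).comp (revOp k V)) (by
    intro a ha
    have h : TwoSidedIdeal.span (⋃ s, (D.R s : Set (TensorAlgebra k V))) ≤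
        TwoSidedIdeal.ker ((AlgHom.op E.proj).comp (revOp k V)) := by
      rw [TwoSidedIdeal.span_le]
      intro x hx
      obtain ⟨s, hs⟩ := Set.mem_iUnion.1 hx
      refine (TwoSidedIdeal.mem_ker _).2 (MulOpposite.unop_injective ?_)
      exact E.proj_eq_zero s (h s ▸ Submodule.mem_map_of_mem hs)
    exact (TwoSidedIdeal.mem_ker _).1 (h ha))

/-- The anti-isomorphism `A → A°` as a linear map. -/
def IsOpposite.algMap (h : D.IsOpposite E) : D.Alg →ₗ[k] E.Alg :=
  (MulOpposite.opLinearEquiv k).symm.toLinearMap ∘ₗ h.algOp.toLinearMap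

theorem IsOpposite.algMap_proj (h : D.IsOpposite E) (t : TensorAlgebra k V) :
    h.algMap (D.proj t) = E.proj (rev k V t) := rfl

theorem IsOpposite.algMap_mul (h : D.IsOpposite E) (a b : D.Alg) :
    h.algMap (a * b) = h.algMap b * h.algMap a := by
  simp [algMap]

theorem IsOpposite.aug_algMap (h : D.IsOpposite E) (a : D.Alg) :
    E.aug (h.algMap a) = D.aug a := by
  obtain ⟨t, rfl⟩ := Ideal.Quotient.mk_surjective a
  change TensorAlgebra.algebraMapInv (rev k V t) = TensorAlgebra.algebraMapInv t
  induction t using TensorAlgebra.induction with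
  | algebraMap r => simp [Algebra.algebraMap_eq_smul_one, rev_one]
  | ι v => rw [rev_ι]
  | mul a b ha hb => rw [rev_mul, map_mul, map_mul, ha, hb, mul_comm]
  | add a b ha hb => rw [map_add, map_add, map_add, ha, hb]

theorem IsOpposite.algMap_algMap (h : D.IsOpposite E) (a : D.Alg) :
    h.symm.algMap (h.algMap a) = a := by
  obtain ⟨t, rfl⟩ := Ideal.Quotient.mk_surjective a
  exact congrArg D.proj (rev_rev t)

/-- The anti-isomorphism `A → A°` as a linear equivalence. -/
def IsOpposite.algEquiv (h : D.IsOpposite E) : D.Alg ≃ₗ[k] E.Alg :=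
  LinearEquiv.ofLinearMap h.algMap h.symm.algMap
    (LinearMap.ext h.symm.algMap_algMap) (LinearMap.ext h.algMap_algMap)

/-- The reversal as an isomorphism between the summands of `J_i` for `A` and for `A°`. -/
def IsOpposite.JsubEquiv (h : D.IsOpposite E) (i : ℕ) (c : Idx S i) :
    D.Jsub i c ≃ₗ[k] E.Jsub i c :=
  Submodule.equivMapOfInjective (rev k V) rev_injective (D.Jsub i c) ≪≫ₗ
    LinearEquiv.ofEq _ _ (h.map_rev_Jsub i c)

theorem IsOpposite.coe_JsubEquiv (h : D.IsOpposite E) (i : ℕ) (c : Idx S i) (x : D.Jsub i c) :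
    (h.JsubEquiv i c x : TensorAlgebra k V) = rev k V x := rfl

/-- The reversal as an isomorphism between the spaces `J_i` for `A` and for `A°`. -/
def IsOpposite.JEquiv (h : D.IsOpposite E) (i : ℕ) : D.J i ≃ₗ[k] E.J i :=
  DFinsupp.mapRange.linearEquiv (h.JsubEquiv i)

theorem IsOpposite.JEquiv_lof (h : D.IsOpposite E) (i : ℕ) (c : Idx S i) (x : D.Jsub i c) :
    h.JEquiv i (DirectSum.lof k _ (fun c => D.Jsub i c) c x) =
      DirectSum.lof k _ (fun c => E.Jsub i c) c (h.JsubEquiv i c x) :=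
  DFinsupp.mapRange_single (hf := fun c => map_zero (h.JsubEquiv i c))

/-- The isomorphism between the terms of the left complex of `A` and the right complex of `A°`. -/
def IsOpposite.KEquiv (h : D.IsOpposite E) (i : ℕ) : D.KLeft i ≃ₗ[k] E.KRight i :=
  TensorProduct.comm k D.Alg (D.J i) ≪≫ₗ TensorProduct.congr (h.JEquiv i) h.algEquiv

theorem IsOpposite.KEquiv_tmul (h : D.IsOpposite E) (i : ℕ) (a : D.Alg) (x : D.J i) :
    h.KEquiv i (a ⊗ₜ x) = h.JEquiv i x ⊗ₜ h.algMap a := rfl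

/-- The identification is semilinear along A → (A°)ᵒᵖ. This suffices, because exactness concerns
only the underlying maps. -/
theorem IsOpposite.KEquiv_smul (h : D.IsOpposite E) (i : ℕ) (a : D.Alg) (z : D.KLeft i) :
    h.KEquiv i (a • z) = MulOpposite.op (h.algMap a) • h.KEquiv i z := by
  induction z using TensorProduct.induction_on with
  | zero => simp
  | add x y hx hy => simp only [smul_add, map_add, hx, hy]
  | tmul b x =>
    rw [TensorProduct.smul_tmul', KEquiv_tmul, KEquiv_tmul, op_smul_tmul, smul_eq_mul, algMap_mul]

theorem IsOpposite.augRight_KEquiv (h : D.IsOpposite E) (z : D.KLeft 0) :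
    E.augRight (h.KEquiv 0 z) = E.toTriv (D.toTriv.symm (D.augLeft z)) := by
  induction z using TensorProduct.induction_on with
  | zero =>
    rw [(h.KEquiv 0).map_zero, E.augRight.map_zero, D.augLeft.map_zero, map_zero, map_zero]
  | add x y hx hy =>
    rw [(h.KEquiv 0).map_add, E.augRight.map_add, D.augLeft.map_add, map_add, map_add, hx, hy]
  | tmul a x =>
    induction x using DirectSum.induction_on with
    | zero =>
      rw [TensorProduct.tmul_zero, (h.KEquiv 0).map_zero, E.augRight.map_zero, D.augLeft.map_zero,
        map_zero, map_zero]
    | add x y hx hy =>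
      rw [TensorProduct.tmul_add, (h.KEquiv 0).map_add, E.augRight.map_add, D.augLeft.map_add,
        map_add, map_add, hx, hy]
    | of c x =>
      change E.augRight (h.KEquiv 0 (a ⊗ₜ DirectSum.lof k _ (fun c => D.Jsub 0 c) c x)) =
        E.toTriv (D.toTriv.symm (D.augLeft (a ⊗ₜ DirectSum.lof k _ (fun c => D.Jsub 0 c) c x)))
      rw [KEquiv_tmul, JEquiv_lof, augRight_tmul, augLeft_tmul, LinearEquiv.symm_apply_apply,
        aug_algMap, coe_JsubEquiv, ← h.algMap_proj, aug_algMap]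

theorem augLeft_surjective (D : MultiHomogeneous k V S) : Function.Surjective D.augLeft := by
  intro c
  refine ⟨algebraMap k D.Alg (D.toTriv.symm c) ⊗ₜ
    DirectSum.lof k _ (fun c => D.Jsub 0 c) (zeroIdx S) ⟨1, one_mem_tpow⟩, ?_⟩
  rw [augLeft_tmul, map_one, map_one, mul_one, AlgHom.commutes]
  exact D.toTriv.apply_symm_apply c

variable [FiniteDimensional k V]

/-- The element y is kept separate from x and tied to it only by an equation in T(V), since the two
lie in different subspaces. -/
theorem IsOpposite.splitRight_rev (h : D.IsOpposite E) (i n : ℕ) (c : Idx S i)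
    (x : (tpow k V n * D.Jsub i c : Submodule k (TensorAlgebra k V)))
    (y : (E.Jsub i c * tpow k V n : Submodule k (TensorAlgebra k V)))
    (hxy : (y : TensorAlgebra k V) = rev k V x) :
    LinearMap.rTensor E.Alg (DirectSum.lof k _ (fun c => E.Jsub i c) c)
      (E.splitRight n (E.Jsub i c) y) =
    h.KEquiv i (LinearMap.lTensor D.Alg (DirectSum.lof k _ (fun c => D.Jsub i c) c)
      (D.splitLeft n (D.Jsub i c) x)) := by
  obtain ⟨z, rfl⟩ := (linearDisjoint_tpow_left n (D.Jsub i c)).mulMap.surjective x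
  rw [splitLeft, LinearMap.comp_apply, LinearEquiv.coe_coe, LinearEquiv.symm_apply_apply]
  let r : tpow k V n →ₗ[k] tpow k V n := (rev k V).restrict fun u hu =>
    map_rev_tpow (k := k) (V := V) n ▸ Submodule.mem_map_of_mem hu
  -- If x is the product of the pairs u ⊗ w in z, then y is the product of the reversed pairs; both
  -- splittings can now be inverted explicitly.
  have hy : y = (linearDisjoint_tpow_right n (E.Jsub i c)).mulMap
      (TensorProduct.map (h.JsubEquiv i c).toLinearMap r
        (TensorProduct.comm k _ _ z)) := by
    apply Subtype.ext
    rw [hxy]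
    clear hxy
    induction z using TensorProduct.induction_on with
    | zero => simp
    | add x y hx hy => simp only [map_add, Submodule.coe_add, hx, hy]
    | tmul u w => exact rev_mul _ _
  rw [hy, splitRight, LinearMap.comp_apply, LinearEquiv.coe_coe, LinearEquiv.symm_apply_apply]
  clear hy hxy
  induction z using TensorProduct.induction_on with
  | zero => simp
  | add x y hx hy => simp only [map_add, hx, hy]
  | tmul u w =>
    rw [LinearMap.rTensor_tmul, LinearMap.lTensor_tmul, KEquiv_tmul, JEquiv_lof]
    rfl

theorem IsOpposite.dRight_KEquiv (h : D.IsOpposite E) (i : ℕ) (z : D.KLeft (i + 1)) :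
    E.dRight i (h.KEquiv (i + 1) z) = h.KEquiv i (D.dLeft i z) := by
  induction z using TensorProduct.induction_on with
  | zero => simp
  | add x y hx hy => simp only [map_add, hx, hy]
  | tmul a x =>
    induction x using DirectSum.induction_on with
    | zero => simp
    | add x y hx hy => simp only [TensorProduct.tmul_add, map_add, hx, hy]
    | of c x =>
      change E.dRight i (h.KEquiv (i + 1) (a ⊗ₜ
        DirectSum.lof k _ (fun c => D.Jsub (i + 1) c) c x)) = h.KEquiv i (D.dLeft i (a ⊗ₜ
        DirectSum.lof k _ (fun c => D.Jsub (i + 1) c) c x))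
      rw [KEquiv_tmul, JEquiv_lof, dRight, dLeft, liftRight_tmul, liftLeft_tmul,
        DirectSum.toModule_lof, DirectSum.toModule_lof, KEquiv_smul]
      exact congrArg _ (h.splitRight_rev i _ _ _ _ rfl)

/-- `A` is left multi-Koszul if and only if `A°` is right multi-Koszul. -/
theorem IsOpposite.isLeftMultiKoszul_iff (h : D.IsOpposite E) :
    D.IsLeftMultiKoszul ↔ E.IsRightMultiKoszul := by
  have h0 : Function.Exact (D.dLeft 0) D.augLeft ↔ Function.Exact (E.dRight 0) E.augRight :=
    exact_of_bijective (a := h.KEquiv 1) (b := h.KEquiv 0)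
      (c := fun x => E.toTriv (D.toTriv.symm x)) (h.KEquiv 1).surjective (h.KEquiv 0).bijective
      (E.toTriv.injective.comp D.toTriv.symm.injective) (by simp) (h.dRight_KEquiv 0)
      h.augRight_KEquiv
  have hs : ∀ i, Function.Exact (D.dLeft (i + 1)) (D.dLeft i) ↔
      Function.Exact (E.dRight (i + 1)) (E.dRight i) := fun i =>
    exact_of_bijective (a := h.KEquiv (i + 2)) (b := h.KEquiv (i + 1)) (c := h.KEquiv i)
      (h.KEquiv _).surjective (h.KEquiv _).bijective (h.KEquiv _).injective (map_zero _)
      (h.dRight_KEquiv _) (h.dRight_KEquiv _)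
  exact ⟨fun hD => ⟨E.projective_KRight, E.augRight_surjective, h0.1 hD.exact_zero,
    fun i => (hs i).1 (hD.exact_succ i)⟩, fun hE => ⟨fun _ => inferInstance, D.augLeft_surjective,
    h0.2 hE.exact_zero, fun i => (hs i).2 (hE.exact_succ i)⟩⟩

/-- For the converse: A right gives A° left, the implication already proved gives A° right, and this
means A left. -/
theorem isLeftMultiKoszul_iff_isRightMultiKoszul (D : MultiHomogeneous k V S) :
    D.IsLeftMultiKoszul ↔ D.IsRightMultiKoszul :=
  ⟨D.isRightMultiKoszul_of_isLeftMultiKoszul, fun h =>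
    D.isOpposite_opposite.isLeftMultiKoszul_iff.2 (isRightMultiKoszul_of_isLeftMultiKoszul _
      (D.isOpposite_opposite.symm.isLeftMultiKoszul_iff.2 h))⟩

end Opposite
end MultiHomogeneous
end MultiKoszul
end

/-- Passing to A° exchanges left and right, and the first equivalence exchanges them back. -/
theorem mainTheorem9 {k V : Type*} [Field k] [AddCommGroup V] [Module k V]
    [FiniteDimensional k V] (S : Finset ℕ) (A : MultiKoszul.MultiHomogeneous k V S) :
    (A.IsLeftMultiKoszul ↔ A.IsRightMultiKoszul) ∧
      (A.opposite.IsLeftMultiKoszul ↔ A.IsLeftMultiKoszul) ∧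
      (A.opposite.IsRightMultiKoszul ↔ A.IsRightMultiKoszul) :=
  ⟨A.isLeftMultiKoszul_iff_isRightMultiKoszul,
    A.isOpposite_opposite.symm.isLeftMultiKoszul_iff.trans
      A.isLeftMultiKoszul_iff_isRightMultiKoszul.symm,
    A.isOpposite_opposite.isLeftMultiKoszul_iff.symm.trans
      A.isLeftMultiKoszul_iff_isRightMultiKoszul⟩
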